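/- **Setting.** Let $\rho,R>0$, let $k\ge 1$ be an integer and $\alpha=-1/k$. Identify $\mathbb{R}^2$ with $\mathbb{C}$ and let $O=\{x:|x|\le R\}$. Let $\mathcal{K}$ be the Ginibre $\alpha$-determinantal point process on $O$: a random finite set of points of $O$ whose $n$-th correlation function with respect to Lebesgue measure is, for every $n$, $$\rho_n(x_1,\dots,x_n)=\sum_{\tau\in S_n}\alpha^{\,n-\nu(\tau)}\prod_{j=1}^n K(x_j,x_{\tau(j)}),\qquad K(x,y)=\rho\, e^{\pi\rho x\bar y}e^{-\frac{\pi\rho}{2}(|x|^2+|y|^2)},$$ where $\nu(\tau)$ is the number of cycles of $\tau$. A sensor at the origin harvests from the sources in $\mathcal{K}$ the power $$P_H=P_H^{\varepsilon}=\sum_{x\in\mathcal{K}}\beta P_S\frac{G_SG_H\lambda^2}{(4\pi(\varepsilon+|x|))^2},$$ where $\varepsilon\ge0$ is a (small) parameter (for $\varepsilon=0$ the sum is almost surely well defined) and $\beta,P_S,G_S,G_H,\lambda>0$. Its maximum transmission rate is $C=C^\varepsilon=W\log_2\!\big(1+h[P_H-P_C]^+/\sigma^2\big)$, where $P_C,h,\sigma,W>0$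 and $[x]^+=\max(0,x)$. Let $m\ge 0$ be the required rate and put $$\tau_m=\frac{\sigma^2}{h}\big(2^{m/W}-1\big),\qquad \gamma=\sqrt{\frac{\beta P_SG_SG_H\lambda^2}{(4\pi)^2(P_C+\tau_m)}}$$ (so the exponent is $2^m$ when the bandwidth is normalized to $W=1$). For $r\ge0$ let $$B(r)=\Big(\prod_{n\ge0}\Big(1+\alpha\frac{\Gamma(n+1,\pi\rho r^2)}{n!}\Big)\Big)^{-1/\alpha},\qquad \Gamma(z,a)=\int_0^a e^{-t}t^{z-1}\,dt.$$ **Theorem.** The infinite product defining $B(r)$ converges for every $r\ge 0$. For every $\varepsilon\ge0$, $$\Pr(C^\varepsilon<m)=\Pr\big([P_H^\varepsilon-P_C]^+<\tau_m\big)\le\Pr\big(P_H^\varepsilon<P_C+\tau_m\big),$$ and the inequality is an equality if $m>0$. Moreover, both $\Pr(C^\varepsilon<m)$ and $\Pr(P_H^\varepsilon<P_C+\tau_m)$ are bounded above 1. by $B(\min(R,\gamma))$ for all sufficiently small $\varepsilon>0$, provided that $R\ne\gamma$; 2. by $B(\min(R,\gamma))+\delta$ for all sufficiently small $\varepsilon>0$,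 for every $\delta>0$ (without any condition on $R$); 3. by $B(\min(R,\max(0,\gamma-\varepsilon)))$ for every $\varepsilon\ge0$; in particular by $B(\min(R,\gamma))$ for $\varepsilon=0$. -/

import Mathlib

open scoped Topology

noncomputable section

/-- The lower incomplete Gamma function `Γ(s, a) = ∫_0^a e^{-t} t^{s-1} dt`. -/
def lowerIncompleteGamma (s a : ℝ) : ℝ :=
  ∫ t in (0 : ℝ)..a, Real.exp (-t) * t ^ (s - 1)

/-- The Ginibre kernel of density `ρ`; the plane is identified with `ℂ`. -/
def ginibreKernel (ρ : ℝ) (x y : ℂ) : ℂ :=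
  (ρ : ℂ) * Complex.exp ((Real.pi * ρ : ℝ) * x * (starRingEnd ℂ) y)
    * Complex.exp ((-(Real.pi * ρ / 2) * (‖x‖ ^ 2 + ‖y‖ ^ 2) : ℝ))

/-- The `α`-determinant `∑_τ α^{n - ν(τ)} ∏_i A_{i τ(i)}`, where `ν(τ)` is the number of cycles
of the permutation `τ`, fixed points included. For `α = -1` it is the determinant. -/
def alphaDet (α : ℝ) {n : ℕ} (A : Matrix (Fin n) (Fin n) ℂ) : ℂ :=
  ∑ τ : Equiv.Perm (Fin n),
    (α : ℂ) ^ (n - Multiset.card τ.partition.parts) * ∏ i, A i (τ i)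

/-- A (simple, finite) point process on `O`: a random finite set of points of `O` for which the
number of points in every Borel set is a random variable. -/
structure IsPointProcess {Ω : Type*} [MeasurableSpace Ω] (μ : MeasureTheory.Measure Ω)
    (O : Set ℂ) (K : Ω → Finset ℂ) : Prop where
  mem_window : ∀ᵐ ω ∂μ, ∀ x ∈ K ω, x ∈ O
  measurable_count : ∀ A : Set ℂ, MeasurableSet A →
    Measurable fun ω => Set.ncard ((K ω : Set ℂ) ∩ A)

/-- `K` is the `α`-determinantal point process on `O` with kernel `κ` (with respect to Lebesgue
measure): for every `n` its `n`-th correlation function on `O` is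
`(x₁, …, xₙ) ↦ det_α (κ(xᵢ, xⱼ))`. That is, the expectation of the sum of a test function over
all `n`-tuples of distinct points is its integral against that function. -/
structure IsAlphaDPP {Ω : Type*} [MeasurableSpace Ω] (μ : MeasureTheory.Measure Ω)
    (α : ℝ) (O : Set ℂ) (κ : ℂ → ℂ → ℂ) (K : Ω → Finset ℂ) : Prop
    extends IsPointProcess μ O K where
  correlation : ∀ (n : ℕ) (g : (Fin n → ℂ) → ENNReal), Measurable g →
    ∫⁻ ω, ∑ e : Fin n ↪ {x // x ∈ K ω}, g (fun i => (e i : ℂ)) ∂μ =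
      ∫⁻ x in Set.univ.pi (fun _ : Fin n => O),
        g x * ENNReal.ofReal (alphaDet α (Matrix.of fun i j => κ (x i) (x j))).re

/-- Aggregate harvested power at the origin from the sources in `S`; the distance to a source at
`x` is `ε + ‖x‖`. -/
def harvestedPower (β PS GS GH wl ε : ℝ) (S : Finset ℂ) : ℝ :=
  ∑ x ∈ S, β * PS * (GS * GH * wl ^ 2 / (4 * Real.pi * (ε + ‖x‖)) ^ 2)

/-- Maximum transmission rate `W log₂ (1 + h P_T / σ²)` with `P_T = [P_H - P_C]⁺`. -/
def transmissionRate (W h σ PC PH : ℝ) : ℝ :=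
  W * Real.logb 2 (1 + h * (max 0 (PH - PC) / σ ^ 2))

/-- The surplus power `(σ² / h) (2^s - 1)` needed for the rate `s` per unit of bandwidth. -/
def surplusThreshold (h σ s : ℝ) : ℝ :=
  σ ^ 2 / h * ((2 : ℝ) ^ s - 1)

/-- The critical distance for the rate `s` per unit of bandwidth. -/
def criticalRadius (β PS GS GH wl PC h σ s : ℝ) : ℝ :=
  Real.sqrt (β * PS * GS * GH * wl ^ 2 /
    ((4 * Real.pi) ^ 2 * (PC + surplusThreshold h σ s)))

/-- The factors `1 + α Γ(n+1, πρr²) / n!`. -/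
def outageFactor (α ρ r : ℝ) (n : ℕ) : ℝ :=
  1 + α * (lowerIncompleteGamma (n + 1) (Real.pi * ρ * r ^ 2) / n.factorial)

/-- The bound `(∏_{n ≥ 0} (1 + α Γ(n+1, πρr²) / n!))^{-1/α}`. -/
def outageBound (α ρ r : ℝ) : ℝ :=
  (∏' n : ℕ, outageFactor α ρ r n) ^ (-1 / α)

end

/-! Write `T = P_C + τ_m`. A single source at distance `d` delivers `T γ² / d²`, so `P_H < T` forces
the disc of radius `γ - ε` to contain no source. The whole theorem is therefore about void
probabilities of discs, except for small `ε > 0` and `γ < R`, where `B(γ - ε)` is too weak and a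
further gain is needed.

Void probabilities. For `α = -1/k` the `α`-determinant is the mean, over colourings of the indices
by `k` colours, of determinants in which only equally coloured indices interact
(`alphaDet_eq_sum_det`). The Ginibre kernel is a sum of functions that are orthogonal on every
centred disc, by rotation invariance, with squared norms `p_a = Γ(a+1, πρr²)/a!`. For a finite
truncation, the integral of a product weight against the `n`-th correlation function is thus `n!`
times the elementary symmetric function of the numbers `p_a / k`, each repeated `k` times
(`integral_alphaDet_featureKernel`). Dominated convergence removes the truncation, and the
alternating series in `n` sums to `(∏ (1 - p_a/k))^k`. With a weight equal to `1` on a disc and to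
`s` on a surrounding annulus, this gives `E[0^N₁ (1-s)^N₂]` for the two counts `N₁`, `N₂`
(`integral_zero_pow_mul_pow`); at `s = 0` it is `B(r)`.

The gain. If `γ < R`, two sources slightly beyond `γ` already deliver `T`. Outage therefore also
forces at most one source in an annulus around the disc, apart from an event where the thin shell
between `γ - ε` and `γ` is hit, whose probability is `O(ε)` by the first moment. The event `N₁ = 0`,
`N₂ ≤ 1` has probability strictly below `B(γ)`, because the generating function is strictly midpoint
convex in `s` (`mixedProduct_midpoint_lt`). This fixed gap absorbs the `O(ε)`. -/

/-! ### The `α`-determinant as an average over colourings -/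

/-- The cycles of a permutation, fixed points included, are the classes of `SameCycle`. -/
theorem card_quotient_sameCycle {ι : Type*} [Fintype ι] [DecidableEq ι] (τ : Equiv.Perm ι) :
    Nat.card (Quotient (Equiv.Perm.SameCycle.setoid τ)) = Multiset.card τ.partition.parts := by
  classical
  -- `cycleFactorsFinset` omits the trivial cycles, so a fixed point has to be its own label.
  let F : ι → {c // c ∈ τ.cycleFactorsFinset} ⊕ {x // x ∈ Finset.univ \ τ.support} := fun x =>
    if h : x ∈ τ.support then
      Sum.inl ⟨τ.cycleOf x, Equiv.Perm.cycleOf_mem_cycleFactorsFinset_iff.2 h⟩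
    else Sum.inr ⟨x, by simp [h]⟩
  have hF : ∀ x y, τ.SameCycle x y ↔ F x = F y := by
    intro x y
    by_cases hx : x ∈ τ.support
    · by_cases hy : y ∈ τ.support
      · simp only [F, hx, hy, dif_pos, Sum.inl.injEq, Subtype.mk.injEq]
        exact Equiv.Perm.sameCycle_iff_cycleOf_eq_of_mem_support hx hy
      · simp only [F, hx, hy, dif_pos, dif_neg, not_false_eq_true, reduceCtorEq, iff_false]
        intro h
        rw [Equiv.Perm.mem_support] at hx hy
        exact hx (h.apply_eq_self_iff.2 (not_not.1 hy))
    · by_cases hy : y ∈ τ.support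
      · simp only [F, hx, hy, dif_pos, dif_neg, not_false_eq_true, reduceCtorEq, iff_false]
        intro h
        rw [Equiv.Perm.mem_support] at hx hy
        exact hy (h.apply_eq_self_iff.1 (not_not.1 hx))
      · simp only [F, hx, hy, dif_neg, not_false_eq_true, Sum.inr.injEq, Subtype.mk.injEq]
        constructor
        · intro h
          rw [Equiv.Perm.mem_support, not_not] at hx
          exact h.eq_of_left hx
        · rintro rfl; exact Equiv.Perm.SameCycle.refl _ _
  have hsurj : Function.Surjective F := by
    rintro (⟨c, hc⟩ | ⟨x, hx⟩)
    · obtain ⟨x, hx⟩ := (Equiv.Perm.mem_cycleFactorsFinset_iff.1 hc).1.nonempty_support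
      have hxτ : x ∈ τ.support := Equiv.Perm.mem_cycleFactorsFinset_support_le hc hx
      refine ⟨x, ?_⟩
      simp only [F, hxτ, dif_pos, Sum.inl.injEq, Subtype.mk.injEq]
      exact (Equiv.Perm.cycle_is_cycleOf hx hc).symm
    · have : x ∉ τ.support := by simpa using hx
      exact ⟨x, dif_neg this⟩
  have e : Quotient (Equiv.Perm.SameCycle.setoid τ) ≃
      {c // c ∈ τ.cycleFactorsFinset} ⊕ {x // x ∈ Finset.univ \ τ.support} :=
    Equiv.ofBijective (Quotient.lift F fun x y h => (hF x y).1 h)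
      ⟨by
        rintro ⟨x⟩ ⟨y⟩ h
        exact Quotient.sound ((hF x y).2 h),
       fun b => by
        obtain ⟨x, rfl⟩ := hsurj b
        exact ⟨Quotient.mk _ x, rfl⟩⟩
  rw [Nat.card_congr e, Nat.card_eq_fintype_card, Fintype.card_sum, Fintype.card_coe,
    Fintype.card_coe, Equiv.Perm.parts_partition, Multiset.card_add, Multiset.card_replicate,
    Equiv.Perm.cycleType_def, Multiset.card_map, Finset.card_val,
    Finset.card_sdiff_of_subset (Finset.subset_univ _), Finset.card_univ]

/-- The colourings invariant under a permutation are those constant on its cycles. -/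
theorem card_invariant_colourings {ι : Type*} [Fintype ι] [DecidableEq ι] (τ : Equiv.Perm ι)
    (k : ℕ) :
    (Finset.univ.filter fun c : ι → Fin k => ∀ i, c i = c (τ i)).card =
      k ^ Multiset.card τ.partition.parts := by
  classical
  have e : {c : ι → Fin k // ∀ i, c i = c (τ i)} ≃
      (Quotient (Equiv.Perm.SameCycle.setoid τ) → Fin k) :=
    { toFun := fun c => Quotient.lift c.1 (by
        have hpow : ∀ (m : ℕ) x, c.1 ((τ ^ m) x) = c.1 x := by
          intro m
          induction m with
          | zero => simp
          | succ m ih => intro x; rw [pow_succ', Equiv.Perm.mul_apply, ← c.2, ih]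
        intro x y h
        obtain ⟨m, -, hm⟩ := Equiv.Perm.SameCycle.exists_pow_eq' (show τ.SameCycle x y from h)
        rw [← hm, hpow])
      invFun := fun d => ⟨fun i => d (Quotient.mk _ i), fun i =>
        congrArg d (Quotient.sound
          (Equiv.Perm.sameCycle_apply_right.2 (Equiv.Perm.SameCycle.refl τ i)))⟩
      left_inv := fun c => rfl
      right_inv := fun d => by
        funext q
        induction q using Quotient.inductionOn with
        | h x => rfl }
  rw [← Fintype.card_subtype, ← Nat.card_eq_fintype_card, Nat.card_congr e, Nat.card_fun,
    card_quotient_sameCycle, Nat.card_eq_fintype_card, Fintype.card_fin]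

/-- A cycle of length `l` has sign `(-1)^(l-1)`, and fixed points contribute nothing to the sum of
the `l - 1`. The inequality makes the truncated subtraction in the exponent a genuine one. -/
theorem sign_eq_neg_one_pow_sub_card_parts {ι : Type*} [Fintype ι] [DecidableEq ι]
    (τ : Equiv.Perm ι) :
    Multiset.card τ.partition.parts ≤ Fintype.card ι ∧
      (Equiv.Perm.sign τ : ℤ) = (-1) ^ (Fintype.card ι - Multiset.card τ.partition.parts) := by
  have h1 : Multiset.card τ.cycleType ≤ τ.support.card := by
    rw [← Equiv.Perm.sum_cycleType]
    have := Multiset.card_nsmul_le_sum (s := τ.cycleType) (a := 1) fun x hx =>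
      (Equiv.Perm.one_lt_of_mem_cycleType hx).le
    simpa using this
  have h2 : τ.support.card ≤ Fintype.card ι := Finset.card_le_univ _
  rw [Equiv.Perm.parts_partition, Multiset.card_add, Multiset.card_replicate,
    Equiv.Perm.sign_of_cycleType, Equiv.Perm.sum_cycleType]
  refine ⟨by omega, ?_⟩
  have h3 : Fintype.card ι - (Multiset.card τ.cycleType + (Fintype.card ι - τ.support.card)) =
      τ.support.card - Multiset.card τ.cycleType := by omega
  have h4 : τ.support.card + Multiset.card τ.cycleType =
      (τ.support.card - Multiset.card τ.cycleType) + 2 * Multiset.card τ.cycleType := by omega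
  rw [h3, h4, pow_add, pow_mul]
  simp

/-- For `α = -1 / k` the `α`-determinant is an average of determinants over colourings. -/
theorem alphaDet_eq_sum_det {k : ℕ} (hk : 1 ≤ k) {n : ℕ} (A : Matrix (Fin n) (Fin n) ℂ) :
    alphaDet (-1 / (k : ℝ)) A =
      ((k : ℂ) ^ n)⁻¹ * ∑ c : Fin n → Fin k,
        (Matrix.of fun i j => if c i = c j then A i j else 0).det := by
  classical
  have hk0 : (k : ℂ) ≠ 0 := by exact_mod_cast (by omega : k ≠ 0)
  simp_rw [Matrix.det_apply']
  rw [Finset.sum_comm]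
  -- For fixed `τ` only the colourings constant on its cycles survive, and there are `k^ν(τ)` of
  -- them.
  have key : ∀ τ : Equiv.Perm (Fin n), ∑ c : Fin n → Fin k, ((Equiv.Perm.sign τ : ℤ) : ℂ) *
      ∏ i, (Matrix.of fun i j => if c i = c j then A i j else 0) (τ i) i =
      ((Equiv.Perm.sign τ : ℤ) : ℂ) * (k : ℂ) ^ Multiset.card τ.partition.parts *
        ∏ i, A (τ i) i := by
    intro τ
    have : ∀ c : Fin n → Fin k,
        ∏ i, (Matrix.of fun i j => if c i = c j then A i j else 0) (τ i) i =
        if (∀ i, c i = c (τ i)) then ∏ i, A (τ i) i else 0 := by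
      intro c
      simp only [Matrix.of_apply]
      rw [Finset.prod_ite_zero]
      simp [eq_comm]
    have hc : (Finset.univ.filter fun c : Fin n → Fin k => ∀ i, c i = c (τ i)).card =
        k ^ Multiset.card τ.partition.parts := by
      convert card_invariant_colourings τ k
    simp_rw [this, mul_ite, mul_zero]
    rw [← Finset.sum_filter, Finset.sum_const, hc, nsmul_eq_mul]
    push_cast; ring
  simp_rw [key]
  -- The determinant is expanded along `A (τ i) i`, the `α`-determinant along `A i (τ i)`; inversion
  -- matches them and keeps the number of cycles.
  rw [Finset.mul_sum, alphaDet, ← Equiv.sum_comp (Equiv.inv (Equiv.Perm (Fin n)))]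
  refine Finset.sum_congr rfl fun τ _ => ?_
  have hτ : Multiset.card (τ⁻¹).partition.parts = Multiset.card τ.partition.parts := by
    simp [Equiv.Perm.parts_partition]
  obtain ⟨hle, hs⟩ := sign_eq_neg_one_pow_sub_card_parts τ
  have hprod : ∏ i, A i (τ⁻¹ i) = ∏ i, A (τ i) i := by
    rw [← Equiv.prod_comp τ]; simp
  change _ ^ (n - Multiset.card (τ⁻¹).partition.parts) * ∏ i, A i (τ⁻¹ i) = _
  rw [hτ, hprod, hs]
  generalize Multiset.card τ.partition.parts = p at *
  generalize ∏ i, A (τ i) i = z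
  rw [Fintype.card_fin] at hle ⊢
  obtain ⟨d, hd⟩ := Nat.exists_eq_add_of_le hle
  subst hd
  rw [Nat.add_sub_cancel_left]
  push_cast
  rw [pow_add, div_pow]
  field_simp

/-! ### Finite-rank kernels: positivity and correlation integrals -/

/-- Each `n`-element subset is the image of exactly `n!` embeddings, one for each enumeration of it.
-/
theorem sum_embedding_prod {ι R : Type*} [Fintype ι] [DecidableEq ι] [CommSemiring R]
    (n : ℕ) (g : ι → R) :
    ∑ e : Fin n ↪ ι, ∏ i, g (e i) =
      (n.factorial : R) * ∑ S ∈ Finset.powersetCard n Finset.univ, ∏ x ∈ S, g x := by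
  classical
  have hmap : ∀ e ∈ (Finset.univ : Finset (Fin n ↪ ι)),
      Finset.univ.map e ∈ Finset.powersetCard n (Finset.univ : Finset ι) := by
    intro e _
    simp [Finset.mem_powersetCard]
  rw [← Finset.sum_fiberwise_of_maps_to hmap, Finset.mul_sum]
  refine Finset.sum_congr rfl fun S hS => ?_
  have hSn : S.card = n := (Finset.mem_powersetCard.1 hS).2
  have h1 : ∀ e ∈ Finset.univ.filter (fun e : Fin n ↪ ι => Finset.univ.map e = S),
      ∏ i, g (e i) = ∏ x ∈ S, g x := by
    intro e he
    rw [← (Finset.mem_filter.1 he).2, Finset.prod_map]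
  rw [Finset.sum_congr rfl h1, Finset.sum_const, nsmul_eq_mul]
  congr 2
  have e : {e : Fin n ↪ ι // Finset.univ.map e = S} ≃ (Fin n ≃ S) :=
    { toFun := fun e => Equiv.ofBijective
        (fun i => (⟨e.1 i, by
            have h := Finset.mem_map_of_mem e.1 (Finset.mem_univ i)
            rwa [e.2] at h⟩ : S))
        ⟨fun i j h => e.1.injective (congrArg Subtype.val h), fun x => by
          have hx : x.1 ∈ Finset.univ.map e.1 := by rw [e.2]; exact x.2
          obtain ⟨i, -, hi⟩ := Finset.mem_map.1 hx
          exact ⟨i, Subtype.ext hi⟩⟩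
      invFun := fun f => ⟨f.toEmbedding.trans (Function.Embedding.subtype _), by
        ext x
        simp only [Finset.mem_map, Finset.mem_univ, true_and]
        constructor
        · rintro ⟨i, rfl⟩; exact (f i).2
        · intro hx; exact ⟨f.symm ⟨x, hx⟩, by simp⟩⟩
      left_inv := fun e => by ext; rfl
      right_inv := fun f => by ext; rfl }
  have f : Fin n ≃ S := (finCongr hSn.symm).trans S.equivFin.symm
  rw [← Fintype.card_subtype, Fintype.card_congr e, Fintype.card_equiv f, Fintype.card_fin]

/-- The kernel `∑ₐ φₐ(x) conj φₐ(y)` of a finite family of functions. -/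
def featureKernel {X : Type*} {N : ℕ} (φ : Fin N → X → ℂ) (x y : X) : ℂ :=
  ∑ a, φ a x * (starRingEnd ℂ) (φ a y)

theorem prod_ite_zero_of_iff {ι R : Type*} [Fintype ι] [CommMonoidWithZero R] (p : ι → Prop)
    [∀ i, Decidable (p i)] (q : Prop) [Decidable q] (h : (∀ i, p i) ↔ q) (g : ι → R) :
    ∏ i, (if p i then g i else 0) = if q then ∏ i, g i else 0 := by
  classical
  split_ifs with hq
  · exact Finset.prod_congr rfl fun i _ => if_pos (h.2 hq i)
  · obtain ⟨i, hi⟩ := not_forall.1 (fun h' => hq (h.1 h'))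
    exact Finset.prod_eq_zero (Finset.mem_univ i) (if_neg hi)

open scoped ComplexOrder in
-- For each colouring the matrix is a Gram matrix `B Bᴴ`, with columns indexed by pairs (feature,
-- colour), so every determinant in the average is nonnegative.
theorem alphaDet_featureKernel_nonneg {X : Type*} {N k : ℕ} (hk : 1 ≤ k) (φ : Fin N → X → ℂ)
    {n : ℕ} (x : Fin n → X) :
    0 ≤ (alphaDet (-1 / (k : ℝ)) (Matrix.of fun i j => featureKernel φ (x i) (x j))).re := by
  rw [alphaDet_eq_sum_det hk]
  have hc : ∀ c : Fin n → Fin k, 0 ≤ (Matrix.of fun i j =>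
      if c i = c j then (Matrix.of fun i j => featureKernel φ (x i) (x j)) i j else 0).det := by
    intro c
    let B : Matrix (Fin n) (Fin N × Fin k) ℂ :=
      Matrix.of fun i b => if c i = b.2 then φ b.1 (x i) else 0
    have hB : (Matrix.of fun i j =>
        if c i = c j then (Matrix.of fun i j => featureKernel φ (x i) (x j)) i j else 0) =
        B * B.conjTranspose := by
      ext i j
      simp only [Matrix.of_apply, Matrix.mul_apply, Matrix.conjTranspose_apply, B,
        Fintype.sum_prod_type, featureKernel]
      by_cases h : c i = c j
      · rw [if_pos h]
        refine Finset.sum_congr rfl fun a _ => ?_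
        rw [Finset.sum_eq_single (c j)]
        · simp [h]
        · intro d _ hd
          simp [hd.symm]
        · simp
      · rw [if_neg h, eq_comm]
        refine Finset.sum_eq_zero fun a _ => Finset.sum_eq_zero fun d _ => ?_
        by_cases hd : c i = d
        · subst hd
          simp [Ne.symm h]
        · simp [hd]
    rw [hB]
    exact (Matrix.posSemidef_self_mul_conjTranspose B).det_nonneg
  have hs := Finset.sum_nonneg fun c (_ : c ∈ Finset.univ) => hc c
  have hk' : (0 : ℂ) ≤ ((k : ℂ) ^ n)⁻¹ := by
    have : ((k : ℂ) ^ n)⁻¹ = (((k : ℝ) ^ n)⁻¹ : ℝ) := by push_cast; rfl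
    rw [this]
    exact_mod_cast (by positivity : (0 : ℝ) ≤ ((k : ℝ) ^ n)⁻¹)
  exact (Complex.le_def.1 (mul_nonneg hk' hs)).1

theorem forall_perm_iff {ι γ : Type*} (b : ι → γ) (τ : Equiv.Perm ι) :
    (∀ i, b (τ i) = b i) ↔ ∀ i, b (τ⁻¹ i) = b i :=
  ⟨fun h i => by simpa using (h (τ⁻¹ i)).symm, fun h i => by simpa using (h (τ i)).symm⟩

/-- The sum is the determinant of the matrix `1[b i = b j]`: the identity for injective `b`, and a
matrix with two equal rows otherwise. This is what excludes repeated eigenvalue labels. -/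
theorem sum_perm_sign_prod_eq {ι : Type*} [DecidableEq ι] {n : ℕ} (b : Fin n → ι) :
    ∑ τ : Equiv.Perm (Fin n), ((Equiv.Perm.sign τ : ℤ) : ℂ) *
      (if ∀ i, b (τ⁻¹ i) = b i then 1 else 0) = if Function.Injective b then 1 else 0 := by
  have h : (Matrix.of fun i j => if b i = b j then (1 : ℂ) else 0).det =
      ∑ τ : Equiv.Perm (Fin n), ((Equiv.Perm.sign τ : ℤ) : ℂ) *
        (if ∀ i, b (τ⁻¹ i) = b i then 1 else 0) := by
    rw [Matrix.det_apply']
    refine Finset.sum_congr rfl fun τ _ => ?_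
    congr 1
    simp only [Matrix.of_apply]
    rw [prod_ite_zero_of_iff _ (∀ i, b (τ⁻¹ i) = b i) (forall_perm_iff b τ),
      Finset.prod_const_one]
  rw [← h]
  split_ifs with hb
  · have : (Matrix.of fun i j => if b i = b j then (1 : ℂ) else 0) = 1 := by
      ext i j
      simp [Matrix.one_apply, hb.eq_iff]
    rw [this, Matrix.det_one]
  · obtain ⟨i, j, hij, hne⟩ : ∃ i j, b i = b j ∧ i ≠ j := by
      simpa [Function.Injective] using hb
    refine Matrix.det_zero_of_row_eq hne ?_
    ext l
    simp [hij]

theorem sum_embedding_eq_sum_injective {ι R : Type*} [Fintype ι] [DecidableEq ι]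
    [AddCommMonoid R] {n : ℕ} (F : (Fin n → ι) → R) :
    ∑ e : Fin n ↪ ι, F e = ∑ b : Fin n → ι, if Function.Injective b then F b else 0 := by
  classical
  rw [← Finset.sum_filter, ← Finset.sum_subtype_eq_sum_filter]
  rw [← (Equiv.subtypeInjectiveEquivEmbedding (Fin n) ι).sum_comp]
  refine Finset.sum_bij (fun a _ => ⟨a.1, by simpa using a.2⟩) ?_ ?_ ?_ ?_
  · simp
  · intro a _ b _ h; simpa using h
  · intro b _; exact ⟨⟨b.1, by simpa using b.2⟩, by simp, rfl⟩
  · intro a _; rfl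

/-- The integral of a product test function against the correlation functions of a finite rank
`α`-determinantal process with orthogonal features is an elementary symmetric function. -/
theorem integral_alphaDet_featureKernel {X : Type*} [MeasurableSpace X]
    (ν : MeasureTheory.Measure X) [MeasureTheory.SigmaFinite ν] {N k : ℕ} (hk : 1 ≤ k)
    (φ : Fin N → X → ℂ) (f : X → ℂ) (P : Fin N → ℂ)
    (hint : ∀ a b, MeasureTheory.Integrable
      (fun x => f x * (φ a x * (starRingEnd ℂ) (φ b x))) ν)
    (horth : ∀ a b, ∫ x, f x * (φ a x * (starRingEnd ℂ) (φ b x)) ∂ν = if a = b then P a else 0)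
    (n : ℕ) :
    ∫ x : Fin n → X, (∏ i, f (x i)) *
      alphaDet (-1 / (k : ℝ)) (Matrix.of fun i j => featureKernel φ (x i) (x j))
        ∂MeasureTheory.Measure.pi (fun _ => ν) =
      (n.factorial : ℂ) * ∑ S ∈ Finset.powersetCard n (Finset.univ : Finset (Fin N × Fin k)),
        ∏ b ∈ S, P b.1 / k := by
  classical
  -- After full expansion each term is a product of functions of single points, so its integral
  -- factorises and orthogonality forces `a ∘ τ⁻¹ = a`.
  have hexp : ∀ x : Fin n → X, (∏ i, f (x i)) *
      alphaDet (-1 / (k : ℝ)) (Matrix.of fun i j => featureKernel φ (x i) (x j)) =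
      ∑ c : Fin n → Fin k, ∑ τ : Equiv.Perm (Fin n), ∑ a : Fin n → Fin N,
        (((k : ℂ) ^ n)⁻¹ * (((Equiv.Perm.sign τ : ℤ) : ℂ) *
          (if ∀ i, c (τ⁻¹ i) = c i then 1 else 0))) *
          ∏ i, (f (x i) * (φ (a (τ⁻¹ i)) (x i) * (starRingEnd ℂ) (φ (a i) (x i)))) := by
    intro x
    rw [alphaDet_eq_sum_det hk, Finset.mul_sum, Finset.mul_sum]
    refine Finset.sum_congr rfl fun c _ => ?_
    rw [Matrix.det_apply', Finset.mul_sum, Finset.mul_sum]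
    refine Finset.sum_congr rfl fun τ _ => ?_
    have h1 : ∏ i, (Matrix.of fun i j => if c i = c j then
        (Matrix.of fun i j => featureKernel φ (x i) (x j)) i j else 0) (τ i) i =
        (if ∀ i, c (τ⁻¹ i) = c i then 1 else 0) *
          ∑ a : Fin n → Fin N, ∏ i, (φ (a i) (x (τ i)) * (starRingEnd ℂ) (φ (a i) (x i))) := by
      simp only [Matrix.of_apply, featureKernel]
      rw [prod_ite_zero_of_iff _ (∀ i, c (τ⁻¹ i) = c i) (forall_perm_iff c τ),
        Finset.prod_univ_sum, Fintype.piFinset_univ, ite_mul, one_mul, zero_mul]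
    rw [h1, Finset.mul_sum, Finset.mul_sum, Finset.mul_sum, Finset.mul_sum]
    refine Finset.sum_congr rfl fun a _ => ?_
    have h2 : ∏ i, φ (a i) (x (τ i)) = ∏ i, φ (a (τ⁻¹ i)) (x i) := by
      rw [← Equiv.prod_comp τ (fun i => φ (a (τ⁻¹ i)) (x i))]
      simp
    rw [Finset.prod_mul_distrib, Finset.prod_mul_distrib, Finset.prod_mul_distrib, h2]
    ring
  have hI : ∀ (τ : Equiv.Perm (Fin n)) (a : Fin n → Fin N), MeasureTheory.Integrable
      (fun x : Fin n → X => ∏ i, (f (x i) * (φ (a (τ⁻¹ i)) (x i) *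
        (starRingEnd ℂ) (φ (a i) (x i))))) (MeasureTheory.Measure.pi (fun _ => ν)) := by
    intro τ a
    exact MeasureTheory.Integrable.fintype_prod
      (f := fun i x => f x * (φ (a (τ⁻¹ i)) x * (starRingEnd ℂ) (φ (a i) x)))
      fun i => hint _ _
  simp_rw [hexp]
  rw [MeasureTheory.integral_finsetSum _ fun c _ =>
    MeasureTheory.integrable_finsetSum _ fun τ _ =>
      MeasureTheory.integrable_finsetSum _ fun a _ => (hI τ a).const_mul _]
  have hτa : ∀ (c : Fin n → Fin k) (τ : Equiv.Perm (Fin n)) (a : Fin n → Fin N),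
      ∫ x : Fin n → X, (((k : ℂ) ^ n)⁻¹ * (((Equiv.Perm.sign τ : ℤ) : ℂ) *
          (if ∀ i, c (τ⁻¹ i) = c i then 1 else 0))) *
          ∏ i, (f (x i) * (φ (a (τ⁻¹ i)) (x i) * (starRingEnd ℂ) (φ (a i) (x i))))
          ∂MeasureTheory.Measure.pi (fun _ => ν) =
        ((Equiv.Perm.sign τ : ℤ) : ℂ) *
          (if ∀ i, (a (τ⁻¹ i), c (τ⁻¹ i)) = (a i, c i) then 1 else 0) * ∏ i, P (a i) / k := by
    intro c τ a
    rw [MeasureTheory.integral_const_mul, MeasureTheory.integral_fintype_prod_eq_prod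
      (f := fun i x => f x * (φ (a (τ⁻¹ i)) x * (starRingEnd ℂ) (φ (a i) x)))]
    simp_rw [horth]
    rw [prod_ite_zero_of_iff _ (∀ i, a (τ⁻¹ i) = a i) Iff.rfl, Finset.prod_div_distrib, Finset.prod_const, Finset.card_univ,
      Fintype.card_fin]
    by_cases h1 : ∀ i, c (τ⁻¹ i) = c i
    · by_cases h2 : ∀ i, a (τ⁻¹ i) = a i
      · rw [if_pos h1, if_pos h2, if_pos fun i => Prod.ext (h2 i) (h1 i)]
        simp_rw [h2]
        ring
      · rw [if_pos h1, if_neg h2, if_neg fun h => h2 fun i => (Prod.ext_iff.1 (h i)).1]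
        ring
    · have h3 : ¬ ∀ i, (a (τ⁻¹ i), c (τ⁻¹ i)) = (a i, c i) := fun h =>
        h1 fun i => (Prod.ext_iff.1 (h i)).2
      rw [if_neg h1, if_neg h3]
      ring
  have hc : ∀ c : Fin n → Fin k, ∫ x : Fin n → X,
      ∑ τ : Equiv.Perm (Fin n), ∑ a : Fin n → Fin N,
        (((k : ℂ) ^ n)⁻¹ * (((Equiv.Perm.sign τ : ℤ) : ℂ) *
          (if ∀ i, c (τ⁻¹ i) = c i then 1 else 0))) *
          ∏ i, (f (x i) * (φ (a (τ⁻¹ i)) (x i) * (starRingEnd ℂ) (φ (a i) (x i))))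
          ∂MeasureTheory.Measure.pi (fun _ => ν) =
      ∑ a : Fin n → Fin N, (if Function.Injective (fun i => (a i, c i)) then 1 else 0) *
        ∏ i, P (a i) / k := by
    intro c
    rw [MeasureTheory.integral_finsetSum _ fun τ _ =>
      MeasureTheory.integrable_finsetSum _ fun a _ => (hI τ a).const_mul _]
    rw [Finset.sum_congr rfl fun τ _ => MeasureTheory.integral_finsetSum _ fun a _ =>
      (hI τ a).const_mul _]
    rw [Finset.sum_comm]
    refine Finset.sum_congr rfl fun a _ => ?_
    simp_rw [hτa]
    rw [← Finset.sum_mul]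
    congr 1
    exact sum_perm_sign_prod_eq fun i => (a i, c i)
  simp_rw [hc]
  -- Feature and colour together form one label in `Fin N × Fin k`; the surviving terms are the
  -- injective labellings.
  rw [← sum_embedding_prod n (fun b : Fin N × Fin k => P b.1 / k),
    sum_embedding_eq_sum_injective (fun b : Fin n → Fin N × Fin k => ∏ i, P (b i).1 / k),
    ← (Equiv.arrowProdEquivProdArrow (Fin n) (fun _ => Fin N) (fun _ => Fin k)).symm.sum_comp,
    Fintype.sum_prod_type_right]
  refine Finset.sum_congr rfl fun c _ => Finset.sum_congr rfl fun a _ => ?_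
  rw [ite_mul, one_mul, zero_mul]
  rfl

/-! ### Expansion of the Ginibre kernel -/

/-- The orthogonal functions spanning the Ginibre kernel. -/
noncomputable def ginibreFeature (ρ : ℝ) (a : ℕ) (x : ℂ) : ℂ :=
  ((Real.sqrt (ρ * (Real.pi * ρ) ^ a / a.factorial) *
    Real.exp (-(Real.pi * ρ / 2) * ‖x‖ ^ 2) : ℝ) : ℂ) * x ^ a

theorem continuous_ginibreFeature (ρ : ℝ) (a : ℕ) : Continuous (ginibreFeature ρ a) := by
  unfold ginibreFeature
  fun_prop

/-- The normalisation of the features makes their products the successive terms of the exponential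
series in the kernel. -/
theorem ginibreFeature_mul_conj {ρ : ℝ} (hρ : 0 < ρ) (a : ℕ) (x y : ℂ) :
    ginibreFeature ρ a x * (starRingEnd ℂ) (ginibreFeature ρ a y) =
      ((a.factorial : ℂ)⁻¹ * ((Real.pi * ρ : ℝ) * x * (starRingEnd ℂ) y) ^ a) *
        ((ρ : ℂ) * Complex.exp ((-(Real.pi * ρ / 2) * (‖x‖ ^ 2 + ‖y‖ ^ 2) : ℝ))) := by
  have h0 : 0 ≤ ρ * (Real.pi * ρ) ^ a / a.factorial := by positivity
  have h1 : ((Real.sqrt (ρ * (Real.pi * ρ) ^ a / a.factorial) : ℝ) : ℂ) *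
      (Real.sqrt (ρ * (Real.pi * ρ) ^ a / a.factorial) : ℝ) =
      ρ * (Real.pi * ρ : ℝ) ^ a * (a.factorial : ℂ)⁻¹ := by
    rw [← Complex.ofReal_mul, Real.mul_self_sqrt h0]
    push_cast
    rw [div_eq_mul_inv]
  have h2 : ((Real.exp (-(Real.pi * ρ / 2) * ‖x‖ ^ 2) : ℝ) : ℂ) *
      (Real.exp (-(Real.pi * ρ / 2) * ‖y‖ ^ 2) : ℝ) =
      Complex.exp ((-(Real.pi * ρ / 2) * (‖x‖ ^ 2 + ‖y‖ ^ 2) : ℝ)) := by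
    rw [← Complex.ofReal_mul, ← Real.exp_add, Complex.ofReal_exp]
    congr 2
    ring
  unfold ginibreFeature
  generalize Real.sqrt (ρ * (Real.pi * ρ) ^ a / a.factorial) = w at h1 ⊢
  rw [map_mul, Complex.conj_ofReal, map_pow, ← h2, mul_pow, mul_pow, Complex.ofReal_mul,
    Complex.ofReal_mul]
  linear_combination (((Real.exp (-(Real.pi * ρ / 2) * ‖x‖ ^ 2) : ℝ) : ℂ) *
      (Real.exp (-(Real.pi * ρ / 2) * ‖y‖ ^ 2) : ℝ)) * x ^ a * (starRingEnd ℂ) y ^ a * h1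

theorem hasSum_ginibreFeature {ρ : ℝ} (hρ : 0 < ρ) (x y : ℂ) :
    HasSum (fun a => ginibreFeature ρ a x * (starRingEnd ℂ) (ginibreFeature ρ a y))
      (ginibreKernel ρ x y) := by
  simp_rw [ginibreFeature_mul_conj hρ]
  have h := (NormedSpace.exp_series_hasSum_exp' (𝕂 := ℂ)
    ((Real.pi * ρ : ℝ) * x * (starRingEnd ℂ) y)).mul_right
    ((ρ : ℂ) * Complex.exp ((-(Real.pi * ρ / 2) * (‖x‖ ^ 2 + ‖y‖ ^ 2) : ℝ)))
  rw [← Complex.exp_eq_exp_ℂ] at h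
  have hk : ginibreKernel ρ x y = Complex.exp ((Real.pi * ρ : ℝ) * x * (starRingEnd ℂ) y) *
      ((ρ : ℂ) * Complex.exp ((-(Real.pi * ρ / 2) * (‖x‖ ^ 2 + ‖y‖ ^ 2) : ℝ))) := by
    unfold ginibreKernel
    ring
  rw [hk]
  simpa only [smul_eq_mul] using h

/-- The rank `N` truncation of the Ginibre kernel. -/
noncomputable def truncatedGinibre (ρ : ℝ) (N : ℕ) : ℂ → ℂ → ℂ :=
  featureKernel fun a : Fin N => ginibreFeature ρ a

theorem tendsto_truncatedGinibre {ρ : ℝ} (hρ : 0 < ρ) (x y : ℂ) :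
    Filter.Tendsto (fun N => truncatedGinibre ρ N x y) Filter.atTop
      (𝓝 (ginibreKernel ρ x y)) := by
  have h := (hasSum_ginibreFeature hρ x y).tendsto_sum_nat
  simp_rw [Finset.sum_range] at h
  exact h

theorem continuous_truncatedGinibre (ρ : ℝ) (N : ℕ) :
    Continuous fun p : ℂ × ℂ => truncatedGinibre ρ N p.1 p.2 := by
  unfold truncatedGinibre featureKernel
  refine continuous_finsetSum _ fun a _ => ?_
  exact ((continuous_ginibreFeature ρ a).comp continuous_fst).mul
    (Complex.continuous_conj.comp ((continuous_ginibreFeature ρ a).comp continuous_snd))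

/-- The bound does not depend on `N`, as dominated convergence requires. -/
theorem norm_truncatedGinibre_le {ρ : ℝ} (hρ : 0 < ρ) (N : ℕ) {R : ℝ} {x y : ℂ}
    (hx : ‖x‖ ≤ R) (hy : ‖y‖ ≤ R) :
    ‖truncatedGinibre ρ N x y‖ ≤ ρ * Real.exp (Real.pi * ρ * R ^ 2) := by
  have hterm : ∀ a : ℕ, ‖ginibreFeature ρ a x * (starRingEnd ℂ) (ginibreFeature ρ a y)‖ ≤
      ρ * ((Real.pi * ρ * R ^ 2) ^ a / a.factorial) := by
    intro a
    rw [ginibreFeature_mul_conj hρ, norm_mul, norm_mul, norm_mul, norm_pow, norm_mul, norm_mul,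
      Complex.norm_exp, RCLike.norm_conj, Complex.norm_real, Complex.norm_real, Complex.ofReal_re,
      norm_inv, Complex.norm_natCast, Real.norm_of_nonneg hρ.le,
      Real.norm_of_nonneg (by positivity : 0 ≤ Real.pi * ρ)]
    have h1 : Real.exp (-(Real.pi * ρ / 2) * (‖x‖ ^ 2 + ‖y‖ ^ 2)) ≤ 1 := by
      rw [Real.exp_le_one_iff]
      have : 0 ≤ Real.pi * ρ / 2 * (‖x‖ ^ 2 + ‖y‖ ^ 2) := by positivity
      linarith
    have hR : 0 ≤ R := (norm_nonneg x).trans hx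
    have h2 : Real.pi * ρ * ‖x‖ * ‖y‖ ≤ Real.pi * ρ * R ^ 2 := by
      rw [mul_assoc, sq]
      gcongr
    calc _ ≤ (a.factorial : ℝ)⁻¹ * (Real.pi * ρ * R ^ 2) ^ a * (ρ * 1) := by gcongr
      _ = _ := by ring
  calc ‖truncatedGinibre ρ N x y‖
      ≤ ∑ a : Fin N, ρ * ((Real.pi * ρ * R ^ 2) ^ (a : ℕ) / (a : ℕ).factorial) :=
        (norm_sum_le (Finset.univ : Finset (Fin N)) _).trans
          (Finset.sum_le_sum fun a _ => hterm a)
    _ ≤ ρ * Real.exp (Real.pi * ρ * R ^ 2) := by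
        rw [← Finset.mul_sum,
          ← Finset.sum_range fun a => (Real.pi * ρ * R ^ 2) ^ a / (a.factorial : ℝ)]
        gcongr
        exact Real.sum_le_exp_of_nonneg (by positivity) _

/-! ### Eigenvalues and orthogonality on discs -/

/-- The eigenvalues of the Ginibre kernel on the disc of radius `r`. -/
noncomputable def ginibreMass (ρ r : ℝ) (a : ℕ) : ℝ :=
  lowerIncompleteGamma (a + 1) (Real.pi * ρ * r ^ 2) / a.factorial

theorem lowerIncompleteGamma_nat_add_one (a : ℕ) (c : ℝ) :
    lowerIncompleteGamma (a + 1) c = ∫ t in (0 : ℝ)..c, Real.exp (-t) * t ^ a := by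
  unfold lowerIncompleteGamma
  simp [add_sub_cancel_right, Real.rpow_natCast]

theorem lowerIncompleteGamma_nat_strictMono (a : ℕ) {c d : ℝ} (hc : 0 ≤ c) (hcd : c < d) :
    lowerIncompleteGamma (a + 1) c < lowerIncompleteGamma (a + 1) d := by
  have hi : ∀ u v : ℝ, IntervalIntegrable (fun t => Real.exp (-t) * t ^ a)
      MeasureTheory.volume u v := fun u v => by
    apply Continuous.intervalIntegrable; fun_prop
  rw [lowerIncompleteGamma_nat_add_one, lowerIncompleteGamma_nat_add_one,
    ← intervalIntegral.integral_add_adjacent_intervals (hi 0 c) (hi c d), lt_add_iff_pos_right]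
  refine intervalIntegral.intervalIntegral_pos_of_pos_on (hi c d) (fun t ht => ?_) hcd
  have : 0 < t := hc.trans_lt ht.1
  positivity

theorem lowerIncompleteGamma_zero (s : ℝ) : lowerIncompleteGamma s 0 = 0 := by
  simp [lowerIncompleteGamma]

theorem lowerIncompleteGamma_nat_nonneg (a : ℕ) {c : ℝ} (hc : 0 ≤ c) :
    0 ≤ lowerIncompleteGamma (a + 1) c := by
  rcases hc.eq_or_lt with rfl | h
  · rw [lowerIncompleteGamma_zero]
  · exact (lowerIncompleteGamma_zero (a + 1)) ▸
      (lowerIncompleteGamma_nat_strictMono a le_rfl h).le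

/-- The complete integral is `a!`. Comparing it with the integral up to `c + 1` rather than `c`
gives strictness. -/
theorem lowerIncompleteGamma_nat_lt_factorial (a : ℕ) {c : ℝ} (hc : 0 ≤ c) :
    lowerIncompleteGamma (a + 1) c < a.factorial := by
  refine (lowerIncompleteGamma_nat_strictMono a hc (lt_add_one c)).trans_le ?_
  rw [← Real.Gamma_nat_eq_factorial, Real.Gamma_eq_integral (by positivity), lowerIncompleteGamma,
    intervalIntegral.integral_of_le (by positivity)]
  refine MeasureTheory.setIntegral_mono_set (Real.GammaIntegral_convergent (by positivity)) ?_
    (Filter.Eventually.of_forall fun x hx => hx.1)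
  filter_upwards [MeasureTheory.self_mem_ae_restrict measurableSet_Ioi] with t ht
  have : (0 : ℝ) < t := ht
  simp only [Pi.zero_apply]
  positivity

theorem lowerIncompleteGamma_nat_le (a : ℕ) {c : ℝ} (hc : 0 ≤ c) :
    lowerIncompleteGamma (a + 1) c ≤ c * c ^ a := by
  have hi : ∀ f : ℝ → ℝ, Continuous f → IntervalIntegrable f
      MeasureTheory.volume 0 c := fun f hf => hf.intervalIntegrable _ _
  rw [lowerIncompleteGamma_nat_add_one]
  calc ∫ t in (0 : ℝ)..c, Real.exp (-t) * t ^ a ≤ ∫ _ in (0 : ℝ)..c, c ^ a := by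
        refine intervalIntegral.integral_mono_on hc (hi _ (by fun_prop)) (hi _ (by fun_prop))
          fun t ht => ?_
        calc Real.exp (-t) * t ^ a ≤ 1 * c ^ a := by
              have h0 := ht.1
              gcongr
              · rw [Real.exp_le_one_iff]; linarith
              · exact ht.2
          _ = c ^ a := one_mul _
    _ = c * c ^ a := by simp

theorem ginibreMass_nonneg {ρ : ℝ} (hρ : 0 < ρ) (r : ℝ) (a : ℕ) : 0 ≤ ginibreMass ρ r a :=
  div_nonneg (lowerIncompleteGamma_nat_nonneg a (by positivity)) (by positivity)

theorem ginibreMass_lt_one {ρ : ℝ} (hρ : 0 < ρ) (r : ℝ) (a : ℕ) : ginibreMass ρ r a < 1 := by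
  rw [ginibreMass, div_lt_one (by positivity)]
  exact lowerIncompleteGamma_nat_lt_factorial a (by positivity)

theorem ginibreMass_strictMono {ρ : ℝ} (hρ : 0 < ρ) {r s : ℝ} (hr : 0 ≤ r) (hrs : r < s)
    (a : ℕ) : ginibreMass ρ r a < ginibreMass ρ s a := by
  unfold ginibreMass
  have : Real.pi * ρ * r ^ 2 < Real.pi * ρ * s ^ 2 := by gcongr
  have := lowerIncompleteGamma_nat_strictMono a (by positivity) this
  gcongr

theorem summable_ginibreMass {ρ : ℝ} (hρ : 0 < ρ) (r : ℝ) : Summable (ginibreMass ρ r) := by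
  refine Summable.of_nonneg_of_le (ginibreMass_nonneg hρ r) (fun a => ?_)
    ((Real.summable_pow_div_factorial (Real.pi * ρ * r ^ 2)).mul_left (Real.pi * ρ * r ^ 2))
  rw [ginibreMass, ← mul_div_assoc]
  have := lowerIncompleteGamma_nat_le a (by positivity : 0 ≤ Real.pi * ρ * r ^ 2)
  gcongr

theorem normSq_ginibreFeature {ρ : ℝ} (hρ : 0 < ρ) (a : ℕ) (x : ℂ) :
    ginibreFeature ρ a x * (starRingEnd ℂ) (ginibreFeature ρ a x) =
      ((ρ * (Real.pi * ρ * ‖x‖ ^ 2) ^ a / a.factorial *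
        Real.exp (-(Real.pi * ρ * ‖x‖ ^ 2)) : ℝ) : ℂ) := by
  rw [ginibreFeature_mul_conj hρ, mul_assoc _ x, Complex.mul_conj']
  push_cast
  rw [show -(Real.pi * ρ / 2 : ℂ) * ((‖x‖ : ℂ) ^ 2 + (‖x‖ : ℂ) ^ 2) =
    -(Real.pi * ρ * (‖x‖ : ℂ) ^ 2) by ring]
  ring

/-- Polar coordinates, then the substitution `t = πρy²`. -/
theorem integral_disc_normSq_ginibreFeature {ρ : ℝ} (hρ : 0 < ρ) (a : ℕ) {r : ℝ} (hr : 0 ≤ r) :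
    ∫ x in Metric.closedBall (0 : ℂ) r,
      ginibreFeature ρ a x * (starRingEnd ℂ) (ginibreFeature ρ a x) = ginibreMass ρ r a := by
  simp_rw [normSq_ginibreFeature hρ]
  rw [integral_complex_ofReal]
  congr 1
  let h : ℝ → ℝ := fun t => ρ * (Real.pi * ρ * t ^ 2) ^ a / a.factorial *
        Real.exp (-(Real.pi * ρ * t ^ 2))
  have h1 : ∫ x in Metric.closedBall (0 : ℂ) r, h ‖x‖ =
      ∫ x : ℂ, (Set.Iic r).indicator h ‖x‖ := by
    rw [← MeasureTheory.integral_indicator Metric.isClosed_closedBall.measurableSet]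
    refine MeasureTheory.integral_congr_ae (Filter.Eventually.of_forall fun x => ?_)
    by_cases hx : ‖x‖ ≤ r
    · simp [Set.indicator, hx]
    · simp [Set.indicator, hx]
  have h2 : MeasureTheory.volume.real (Metric.ball (0 : ℂ) 1) = Real.pi := by
    simp [MeasureTheory.Measure.real, Complex.volume_ball]
  have h3 : ∫ y in Set.Ioi (0 : ℝ), y • (Set.Iic r).indicator h y =
      ∫ y in (0 : ℝ)..r, y * h y := by
    rw [intervalIntegral.integral_of_le hr, ← Set.Ioi_inter_Iic,
      ← MeasureTheory.setIntegral_indicator measurableSet_Iic]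
    refine MeasureTheory.integral_congr_ae (Filter.Eventually.of_forall fun x => ?_)
    by_cases hx : x ≤ r
    · simp [Set.indicator, hx]
    · simp [Set.indicator, hx]
  have h4 := intervalIntegral.integral_comp_mul_deriv (a := 0) (b := r)
    (f := fun y => Real.pi * ρ * y ^ 2) (f' := fun y => Real.pi * ρ * (2 * y))
    (g := fun t => Real.exp (-t) * t ^ a)
    (fun y _ => by simpa using (hasDerivAt_pow 2 y).const_mul (Real.pi * ρ))
    (by fun_prop) (by fun_prop)
  change ∫ x in Metric.closedBall (0 : ℂ) r, h ‖x‖ = _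
  rw [h1, MeasureTheory.integral_fun_norm_addHaar, Complex.finrank_real_complex, h2]
  simp only [Nat.add_one_sub_one, pow_one]
  rw [h3, ginibreMass, lowerIncompleteGamma_nat_add_one]
  simp only [ne_eq, OfNat.ofNat_ne_zero, not_false_eq_true, zero_pow, mul_zero] at h4
  rw [← h4, nsmul_eq_mul, smul_eq_mul, ← intervalIntegral.integral_div,
    ← intervalIntegral.integral_const_mul, ← intervalIntegral.integral_const_mul]
  refine intervalIntegral.integral_congr fun y _ => ?_
  simp only [h, Function.comp]
  push_cast
  ring

/-- The disc is invariant under rotation by `u`, which multiplies the integrand by `u^a ū^b`; one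
rotation for which this factor is not `1` forces the integral to vanish. -/
theorem integral_disc_ginibreFeature_of_ne {ρ : ℝ} {a b : ℕ} (hab : a ≠ b) (r : ℝ) :
    ∫ x in Metric.closedBall (0 : ℂ) r,
      ginibreFeature ρ a x * (starRingEnd ℂ) (ginibreFeature ρ b x) = 0 := by
  set I := ∫ x in Metric.closedBall (0 : ℂ) r,
      ginibreFeature ρ a x * (starRingEnd ℂ) (ginibreFeature ρ b x) with hI
  obtain ⟨u, hne⟩ : ∃ u : Circle, (u : ℂ) ^ a * (starRingEnd ℂ) (u : ℂ) ^ b ≠ 1 := by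
    have hne : (a : ℂ) - b ≠ 0 := sub_ne_zero.2 (by exact_mod_cast hab)
    -- This angle makes the factor `e^{iπ} = -1`.
    refine ⟨Circle.exp (Real.pi / ((a : ℝ) - b)), ?_⟩
    rw [← Circle.coe_inv_eq_conj, ← Circle.exp_neg, Circle.coe_exp, Circle.coe_exp,
      ← Complex.exp_nat_mul, ← Complex.exp_nat_mul, ← Complex.exp_add]
    have : (a : ℂ) * (((Real.pi / ((a : ℝ) - b) : ℝ) : ℂ) * Complex.I) +
        b * (((-(Real.pi / ((a : ℝ) - b)) : ℝ) : ℂ) * Complex.I) = Real.pi * Complex.I := by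
      push_cast
      field_simp
      ring
    rw [this, Complex.exp_pi_mul_I]
    norm_num
  have h1 : I = ((u : ℂ) ^ a * (starRingEnd ℂ) (u : ℂ) ^ b) * I := by
    have hmp := (rotation u).measurePreserving
    have hpre : (rotation u) ⁻¹' Metric.closedBall (0 : ℂ) r = Metric.closedBall 0 r := by
      ext x
      rw [Set.mem_preimage, mem_closedBall_zero_iff, mem_closedBall_zero_iff,
        LinearIsometryEquiv.norm_map]
    conv_lhs => rw [hI, ← hmp.setIntegral_preimage_emb
      (rotation u).toHomeomorph.measurableEmbedding, hpre]
    rw [hI, ← MeasureTheory.integral_const_mul]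
    congr 1
    ext x
    simp only [rotation_apply, ginibreFeature, norm_mul, Circle.norm_coe, one_mul, map_mul,
      map_pow, mul_pow]
    ring
  have h2 : (1 - (u : ℂ) ^ a * (starRingEnd ℂ) (u : ℂ) ^ b) * I = 0 := by
    linear_combination h1
  rcases mul_eq_zero.1 h2 with h | h
  · exact absurd (sub_eq_zero.1 h).symm hne
  · exact h

/-! ### Regularity and positivity of the correlation functions -/

theorem continuous_alphaDet_kernel (α : ℝ) {n : ℕ} {κ : ℂ → ℂ → ℂ}
    (hκ : Continuous fun p : ℂ × ℂ => κ p.1 p.2) :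
    Continuous fun x : Fin n → ℂ => alphaDet α (Matrix.of fun i j => κ (x i) (x j)) := by
  unfold alphaDet
  refine continuous_finsetSum _ fun τ _ => continuous_const.mul ?_
  refine continuous_finsetProd _ fun i _ => ?_
  have hp : Continuous fun x : Fin n → ℂ => (x i, x (τ i)) := by fun_prop
  exact hκ.comp hp

theorem continuous_ginibreKernel (ρ : ℝ) :
    Continuous fun p : ℂ × ℂ => ginibreKernel ρ p.1 p.2 := by
  unfold ginibreKernel
  have h : Continuous fun p : ℂ × ℂ => (starRingEnd ℂ) p.2 :=
    Complex.continuous_conj.comp continuous_snd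
  fun_prop

theorem norm_alphaDet_le {α : ℝ} (hα : |α| ≤ 1) {n : ℕ} (A : Matrix (Fin n) (Fin n) ℂ) {M : ℝ}
    (hA : ∀ i j, ‖A i j‖ ≤ M) : ‖alphaDet α A‖ ≤ n.factorial * M ^ n := by
  have h : ∀ τ : Equiv.Perm (Fin n),
      ‖(α : ℂ) ^ (n - Multiset.card τ.partition.parts) * ∏ i, A i (τ i)‖ ≤ M ^ n := by
    intro τ
    rw [norm_mul, norm_pow, Complex.norm_real, Real.norm_eq_abs, norm_prod]
    have h1 : |α| ^ (n - Multiset.card τ.partition.parts) ≤ 1 := pow_le_one₀ (abs_nonneg _) hα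
    have h2 : ∏ i, ‖A i (τ i)‖ ≤ M ^ n := by
      have := Finset.prod_le_prod (s := Finset.univ) (f := fun i => ‖A i (τ i)‖)
        (g := fun _ => M) (fun i _ => norm_nonneg _) (fun i _ => hA i (τ i))
      simpa using this
    calc _ ≤ 1 * M ^ n := mul_le_mul h1 h2 (Finset.prod_nonneg fun _ _ => norm_nonneg _) zero_le_one
      _ = M ^ n := one_mul _
  calc ‖alphaDet α A‖ ≤ ∑ τ : Equiv.Perm (Fin n), M ^ n :=
        (norm_sum_le _ _).trans (Finset.sum_le_sum fun τ _ => h τ)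
    _ = n.factorial * M ^ n := by simp [Fintype.card_perm]

theorem tendsto_alphaDet_truncatedGinibre {ρ : ℝ} (hρ : 0 < ρ) (α : ℝ) {n : ℕ}
    (x : Fin n → ℂ) :
    Filter.Tendsto (fun N => alphaDet α (Matrix.of fun i j => truncatedGinibre ρ N (x i) (x j)))
      Filter.atTop (𝓝 (alphaDet α (Matrix.of fun i j => ginibreKernel ρ (x i) (x j)))) := by
  unfold alphaDet
  refine tendsto_finsetSum _ fun τ _ => Filter.Tendsto.const_mul _ ?_
  exact tendsto_finsetProd _ fun i _ => tendsto_truncatedGinibre hρ (x i) (x (τ i))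

/-- Positivity passes to the limit from the truncated kernels. It makes `ENNReal.ofReal` harmless in
the correlation identity. -/
theorem alphaDet_ginibreKernel_nonneg {ρ : ℝ} (hρ : 0 < ρ) {k : ℕ} (hk : 1 ≤ k) {n : ℕ}
    (x : Fin n → ℂ) :
    0 ≤ (alphaDet (-1 / (k : ℝ)) (Matrix.of fun i j => ginibreKernel ρ (x i) (x j))).re :=
  ge_of_tendsto' ((Complex.continuous_re.tendsto _).comp
    (tendsto_alphaDet_truncatedGinibre hρ (-1 / (k : ℝ)) x))
    fun _ => alphaDet_featureKernel_nonneg hk _ x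

theorem abs_neg_one_div_natCast_le {k : ℕ} (hk : 1 ≤ k) : |(-1 / (k : ℝ))| ≤ 1 := by
  have : (1 : ℝ) ≤ k := by exact_mod_cast hk
  rw [abs_div, abs_neg, abs_one, abs_of_pos (by linarith)]
  exact (div_le_one (by linarith)).2 this

/-! ### Weights on a disc and an annulus -/

/-- The weight that is `1` on the disc of radius `r₁` and `s` on the annulus between `r₁`
and `r₂`. -/
noncomputable def discWeight (r₁ r₂ s : ℝ) (x : ℂ) : ℝ :=
  if ‖x‖ ≤ r₁ then 1 else if ‖x‖ ≤ r₂ then s else 0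

theorem discWeight_nonneg {r₁ r₂ s : ℝ} (hs : 0 ≤ s) (x : ℂ) : 0 ≤ discWeight r₁ r₂ s x := by
  unfold discWeight
  split_ifs <;> simp [hs]

theorem discWeight_le_one {r₁ r₂ s : ℝ} (hs : s ≤ 1) (x : ℂ) : discWeight r₁ r₂ s x ≤ 1 := by
  unfold discWeight
  split_ifs <;> simp [hs]

theorem measurable_discWeight (r₁ r₂ s : ℝ) : Measurable (discWeight r₁ r₂ s) :=
  Measurable.ite (measurableSet_le measurable_norm measurable_const) measurable_const
    (Measurable.ite (measurableSet_le measurable_norm measurable_const) measurable_const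
      measurable_const)

theorem discWeight_eq_indicator {r₁ r₂ : ℝ} (h : r₁ ≤ r₂) (s : ℝ) (x : ℂ) (z : ℂ) :
    (discWeight r₁ r₂ s x : ℂ) * z =
      (1 - s : ℂ) * (Metric.closedBall (0 : ℂ) r₁).indicator (fun _ => z) x +
        (s : ℂ) * (Metric.closedBall (0 : ℂ) r₂).indicator (fun _ => z) x := by
  unfold discWeight
  by_cases h1 : ‖x‖ ≤ r₁
  · have h2 := h1.trans h
    simp [Set.indicator, h1, h2]
    ring
  · by_cases h2 : ‖x‖ ≤ r₂ <;> simp [Set.indicator, h1, h2]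

/-- The integral of `discWeight` against the squared features. -/
noncomputable def mixedMass (ρ r₁ r₂ s : ℝ) (a : ℕ) : ℝ :=
  (1 - s) * ginibreMass ρ r₁ a + s * ginibreMass ρ r₂ a

theorem mixedMass_nonneg {ρ : ℝ} (hρ : 0 < ρ) {s : ℝ} (hs0 : 0 ≤ s) (hs1 : s ≤ 1) (r₁ r₂ : ℝ)
    (a : ℕ) : 0 ≤ mixedMass ρ r₁ r₂ s a :=
  add_nonneg (mul_nonneg (by linarith) (ginibreMass_nonneg hρ _ _))
    (mul_nonneg hs0 (ginibreMass_nonneg hρ _ _))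

theorem summable_mixedMass {ρ : ℝ} (hρ : 0 < ρ) (r₁ r₂ s : ℝ) :
    Summable (mixedMass ρ r₁ r₂ s) :=
  ((summable_ginibreMass hρ r₁).mul_left _).add ((summable_ginibreMass hρ r₂).mul_left _)

theorem integrableOn_discWeight_feature (ρ : ℝ) {R r₁ r₂ s : ℝ} (hs0 : 0 ≤ s) (hs1 : s ≤ 1)
    (a b : ℕ) :
    MeasureTheory.Integrable (fun x => (discWeight r₁ r₂ s x : ℂ) *
      (ginibreFeature ρ a x * (starRingEnd ℂ) (ginibreFeature ρ b x)))
      (MeasureTheory.volume.restrict (Metric.closedBall 0 R)) := by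
  have hc : Continuous fun x =>
      ginibreFeature ρ a x * (starRingEnd ℂ) (ginibreFeature ρ b x) :=
    (continuous_ginibreFeature ρ a).mul
      (Complex.continuous_conj.comp (continuous_ginibreFeature ρ b))
  refine MeasureTheory.Integrable.bdd_mul (c := 1)
    (hc.continuousOn.integrableOn_compact (isCompact_closedBall 0 R)) ?_ ?_
  · exact (Complex.measurable_ofReal.comp (measurable_discWeight r₁ r₂ s)).aestronglyMeasurable
  · refine Filter.Eventually.of_forall fun x => ?_
    rw [Complex.norm_real, Real.norm_of_nonneg (discWeight_nonneg hs0 x)]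
    exact discWeight_le_one hs1 x

/-- The weight is a combination of indicators of two concentric discs, and the features are
orthogonal on both, so one diagonalisation serves every `s`. -/
theorem integral_discWeight_feature {ρ : ℝ} (hρ : 0 < ρ) {R r₁ r₂ : ℝ} (s : ℝ) (h0 : 0 ≤ r₁)
    (h12 : r₁ ≤ r₂) (h2R : r₂ ≤ R) (a b : ℕ) :
    ∫ x in Metric.closedBall (0 : ℂ) R, (discWeight r₁ r₂ s x : ℂ) *
      (ginibreFeature ρ a x * (starRingEnd ℂ) (ginibreFeature ρ b x)) =
      if a = b then ((mixedMass ρ r₁ r₂ s a : ℝ) : ℂ) else 0 := by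
  set F : ℂ → ℂ := fun x => ginibreFeature ρ a x * (starRingEnd ℂ) (ginibreFeature ρ b x)
    with hF
  have hc : Continuous F := (continuous_ginibreFeature ρ a).mul
      (Complex.continuous_conj.comp (continuous_ginibreFeature ρ b))
  have hdisc : ∀ r, 0 ≤ r → ∫ x in Metric.closedBall (0 : ℂ) r, F x =
      if a = b then ((ginibreMass ρ r a : ℝ) : ℂ) else 0 := by
    intro r hr
    split_ifs with hab
    · subst hab; exact integral_disc_normSq_ginibreFeature hρ a hr
    · exact integral_disc_ginibreFeature_of_ne hab r
  have hind : ∀ r, 0 ≤ r → r ≤ R → ∫ x in Metric.closedBall (0 : ℂ) R,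
      (Metric.closedBall (0 : ℂ) r).indicator F x =
      if a = b then ((ginibreMass ρ r a : ℝ) : ℂ) else 0 := by
    intro r hr hrR
    rw [MeasureTheory.setIntegral_indicator Metric.isClosed_closedBall.measurableSet,
      Set.inter_eq_self_of_subset_right (Metric.closedBall_subset_closedBall hrR), hdisc r hr]
  have hint : ∀ r, MeasureTheory.Integrable ((Metric.closedBall (0 : ℂ) r).indicator F)
      (MeasureTheory.volume.restrict (Metric.closedBall 0 R)) := fun r =>
    MeasureTheory.Integrable.indicator
      (hc.continuousOn.integrableOn_compact (isCompact_closedBall 0 R))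
      Metric.isClosed_closedBall.measurableSet
  have hpt : ∀ x, (discWeight r₁ r₂ s x : ℂ) * F x =
      (1 - s : ℂ) * (Metric.closedBall (0 : ℂ) r₁).indicator F x +
        (s : ℂ) * (Metric.closedBall (0 : ℂ) r₂).indicator F x := by
    intro x
    rw [discWeight_eq_indicator h12]
    simp only [Set.indicator]
  change ∫ x in Metric.closedBall (0 : ℂ) R, (discWeight r₁ r₂ s x : ℂ) * F x = _
  simp_rw [hpt]
  rw [MeasureTheory.integral_add ((hint r₁).const_mul _) ((hint r₂).const_mul _),
    MeasureTheory.integral_const_mul, MeasureTheory.integral_const_mul,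
    hind r₁ h0 (h12.trans h2R), hind r₂ (h0.trans h12) h2R]
  split_ifs
  · rw [mixedMass]; push_cast; ring
  · simp

/-! ### Elementary symmetric functions and the limit of infinite rank -/

/-- The elementary symmetric polynomial of the eigenvalues of the truncated kernel. -/
noncomputable def eigenEsymm (k : ℕ) (p : ℕ → ℝ) (N n : ℕ) : ℝ :=
  ∑ S ∈ Finset.powersetCard n (Finset.univ : Finset (Fin N × Fin k)), ∏ b ∈ S, p b.1 / k

theorem eigenEsymm_nonneg {p : ℕ → ℝ} (hp : ∀ a, 0 ≤ p a) (k N n : ℕ) :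
    0 ≤ eigenEsymm k p N n :=
  Finset.sum_nonneg fun _ _ => Finset.prod_nonneg fun b _ => div_nonneg (hp b.1) (by positivity)

/-- `n! e_n` keeps only the injective terms of the expanded `n`-th power of the sum; summing `p a /
k` over the `k` colours gives back `p a`. The bound is uniform in `N` and summable in `n`. -/
theorem eigenEsymm_le {p : ℕ → ℝ} (hp : ∀ a, 0 ≤ p a) (hsum : Summable p) {k : ℕ} (hk : 1 ≤ k)
    (N n : ℕ) : eigenEsymm k p N n ≤ (∑' a, p a) ^ n / n.factorial := by
  have hk0 : (k : ℝ) ≠ 0 := by exact_mod_cast (by omega : k ≠ 0)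
  rw [le_div_iff₀ (by positivity), mul_comm, eigenEsymm,
    ← sum_embedding_prod n (fun b : Fin N × Fin k => p b.1 / k),
    sum_embedding_eq_sum_injective (fun b : Fin n → Fin N × Fin k => ∏ i, p (b i).1 / k)]
  have hnn : ∀ b : Fin N × Fin k, 0 ≤ p b.1 / k := fun b => div_nonneg (hp b.1) (by positivity)
  have hS : ∑ b : Fin N × Fin k, p b.1 / k ≤ ∑' a, p a := by
    rw [Fintype.sum_prod_type]
    simp only [Finset.sum_const, Finset.card_univ, Fintype.card_fin, nsmul_eq_mul,
      mul_div_cancel₀ _ hk0]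
    rw [← Finset.sum_range fun a => p a]
    exact hsum.sum_le_tsum _ fun a _ => hp a
  calc _ ≤ ∑ b : Fin n → Fin N × Fin k, ∏ i, p (b i).1 / k := by
        refine Finset.sum_le_sum fun b _ => ?_
        split_ifs
        · exact le_rfl
        · exact Finset.prod_nonneg fun i _ => hnn _
    _ = (∑ b : Fin N × Fin k, p b.1 / k) ^ n := by
        rw [Fintype.sum_pow]
    _ ≤ _ := pow_le_pow_left₀ (Finset.sum_nonneg fun b _ => hnn b) hS n

/-- The alternating sum of the elementary symmetric polynomials. -/
theorem hasSum_eigenEsymm (k : ℕ) (p : ℕ → ℝ) (N : ℕ) :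
    HasSum (fun n => (-1 : ℝ) ^ n * eigenEsymm k p N n)
      ((∏ a ∈ Finset.range N, (1 - p a / k)) ^ k) := by
  have h1 : (∏ a ∈ Finset.range N, (1 - p a / k)) ^ k =
      ∏ b : Fin N × Fin k, (1 + -(p b.1 / k)) := by
    rw [Fintype.prod_prod_type]
    simp only [Finset.prod_const, Finset.card_univ, Fintype.card_fin, ← sub_eq_add_neg]
    rw [Finset.prod_pow, ← Finset.prod_range fun a => 1 - p a / k]
  rw [h1, Finset.prod_one_add, Finset.sum_powerset]
  have h2 : ∀ n, (-1 : ℝ) ^ n * eigenEsymm k p N n =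
      ∑ S ∈ Finset.powersetCard n (Finset.univ : Finset (Fin N × Fin k)),
        ∏ b ∈ S, -(p b.1 / k) := by
    intro n
    rw [eigenEsymm, Finset.mul_sum]
    refine Finset.sum_congr rfl fun S hS => ?_
    rw [Finset.prod_neg, (Finset.mem_powersetCard.1 hS).2]
  simp_rw [h2]
  refine hasSum_sum_of_ne_finset_zero fun n hn => ?_
  rw [Finset.powersetCard_eq_empty.2, Finset.sum_empty]
  simpa using hn

instance isFiniteMeasure_restrict_closedBall (R : ℝ) : MeasureTheory.IsFiniteMeasure
    (MeasureTheory.volume.restrict (Metric.closedBall (0 : ℂ) R)) :=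
  ⟨by
    rw [MeasureTheory.Measure.restrict_apply_univ]
    exact MeasureTheory.measure_closedBall_lt_top⟩

section CorrelationIntegral

variable {ρ R r₁ r₂ s : ℝ} {k : ℕ}

/-- The integral of `∏ f(xᵢ)` against the `n`-th correlation function. -/
noncomputable def correlationIntegral (ρ R r₁ r₂ s : ℝ) (k n : ℕ) : ℝ :=
  ∫ x : Fin n → ℂ, (∏ i, discWeight r₁ r₂ s (x i)) *
    (alphaDet (-1 / (k : ℝ)) (Matrix.of fun i j => ginibreKernel ρ (x i) (x j))).re
      ∂MeasureTheory.Measure.pi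
        (fun _ => MeasureTheory.volume.restrict (Metric.closedBall (0 : ℂ) R))

theorem ae_pi_restrict_closedBall (R : ℝ) (n : ℕ) :
    ∀ᵐ x : Fin n → ℂ ∂MeasureTheory.Measure.pi
        (fun _ => MeasureTheory.volume.restrict (Metric.closedBall (0 : ℂ) R)),
      ∀ i, ‖x i‖ ≤ R := by
  rw [← MeasureTheory.Measure.restrict_pi_pi]
  filter_upwards [MeasureTheory.ae_restrict_mem
    (MeasurableSet.univ_pi fun _ => Metric.isClosed_closedBall.measurableSet)] with x hx i
  simpa using hx i (Set.mem_univ i)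

theorem norm_prod_discWeight_mul_le (hs0 : 0 ≤ s) (hs1 : s ≤ 1) {n : ℕ} (x : Fin n → ℂ)
    {z : ℂ} {M : ℝ} (hz : ‖z‖ ≤ M) :
    ‖(∏ i, discWeight r₁ r₂ s (x i)) * z.re‖ ≤ M := by
  have h1 : 0 ≤ ∏ i, discWeight r₁ r₂ s (x i) :=
    Finset.prod_nonneg fun i _ => discWeight_nonneg hs0 _
  have h2 : ∏ i, discWeight r₁ r₂ s (x i) ≤ 1 :=
    Finset.prod_le_one (fun i _ => discWeight_nonneg hs0 _) fun i _ => discWeight_le_one hs1 _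
  rw [norm_mul, Real.norm_of_nonneg h1]
  calc _ ≤ 1 * M := mul_le_mul h2 ((Complex.abs_re_le_norm z).trans hz) (abs_nonneg _) zero_le_one
    _ = M := one_mul M

theorem aestronglyMeasurable_prod_discWeight_mul {κ : ℂ → ℂ → ℂ}
    (hκ : Continuous fun p : ℂ × ℂ => κ p.1 p.2) (α : ℝ) (n : ℕ)
    (ν : MeasureTheory.Measure (Fin n → ℂ)) :
    MeasureTheory.AEStronglyMeasurable (fun x : Fin n → ℂ => (∏ i, discWeight r₁ r₂ s (x i)) *
      (alphaDet α (Matrix.of fun i j => κ (x i) (x j))).re) ν := by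
  refine Measurable.aestronglyMeasurable (Measurable.mul ?_ ?_)
  · exact Finset.measurable_prod _ fun i _ =>
      (measurable_discWeight r₁ r₂ s).comp (measurable_pi_apply i)
  · exact (Complex.continuous_re.comp (continuous_alphaDet_kernel α hκ)).measurable

theorem integral_truncated_eq (hρ : 0 < ρ) (hs0 : 0 ≤ s) (hs1 : s ≤ 1) (h0 : 0 ≤ r₁)
    (h12 : r₁ ≤ r₂) (h2R : r₂ ≤ R) (hk : 1 ≤ k) (N n : ℕ) :
    ∫ x : Fin n → ℂ, (∏ i, discWeight r₁ r₂ s (x i)) *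
      (alphaDet (-1 / (k : ℝ)) (Matrix.of fun i j => truncatedGinibre ρ N (x i) (x j))).re
      ∂MeasureTheory.Measure.pi
        (fun _ => MeasureTheory.volume.restrict (Metric.closedBall (0 : ℂ) R)) =
      n.factorial * eigenEsymm k (mixedMass ρ r₁ r₂ s) N n := by
  have h := integral_alphaDet_featureKernel
    (MeasureTheory.volume.restrict (Metric.closedBall (0 : ℂ) R)) hk
    (fun a : Fin N => ginibreFeature ρ a) (fun x => (discWeight r₁ r₂ s x : ℂ))
    (fun a => ((mixedMass ρ r₁ r₂ s a : ℝ) : ℂ))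
    (fun a b => integrableOn_discWeight_feature ρ hs0 hs1 a b)
    (fun a b => by
      rw [integral_discWeight_feature hρ s h0 h12 h2R]
      simp [Fin.ext_iff]) n
  have hre := congrArg Complex.re h
  rw [← RCLike.re_eq_complex_re, ← integral_re] at hre
  · simp only [RCLike.re_eq_complex_re] at hre
    have hR : ((n.factorial : ℂ) * ∑ S ∈ Finset.powersetCard n
        (Finset.univ : Finset (Fin N × Fin k)),
        ∏ b ∈ S, ((mixedMass ρ r₁ r₂ s b.1 : ℝ) : ℂ) / k) =
        ((n.factorial * eigenEsymm k (mixedMass ρ r₁ r₂ s) N n : ℝ) : ℂ) := by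
      rw [eigenEsymm]; push_cast; rfl
    rw [hR, Complex.ofReal_re] at hre
    rw [← hre]
    refine MeasureTheory.integral_congr_ae (Filter.Eventually.of_forall fun x => ?_)
    simp only
    rw [← Complex.ofReal_prod, Complex.re_ofReal_mul]
    rfl
  · have hm : MeasureTheory.AEStronglyMeasurable (fun x : Fin n → ℂ =>
        (∏ i, (discWeight r₁ r₂ s (x i) : ℂ)) * alphaDet (-1 / (k : ℝ))
          (Matrix.of fun i j => truncatedGinibre ρ N (x i) (x j)))
        (MeasureTheory.Measure.pi
          (fun _ => MeasureTheory.volume.restrict (Metric.closedBall (0 : ℂ) R))) := by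
      refine Measurable.aestronglyMeasurable (Measurable.mul ?_ ?_)
      · exact Finset.measurable_prod _ fun i _ => Complex.measurable_ofReal.comp
          ((measurable_discWeight r₁ r₂ s).comp (measurable_pi_apply i))
      · exact (continuous_alphaDet_kernel _ (continuous_truncatedGinibre ρ N)).measurable
    refine MeasureTheory.Integrable.of_bound hm
      (n.factorial * (ρ * Real.exp (Real.pi * ρ * R ^ 2)) ^ n) ?_
    filter_upwards [ae_pi_restrict_closedBall R n] with x hx
    have h1 : ‖∏ i, (discWeight r₁ r₂ s (x i) : ℂ)‖ ≤ 1 := by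
      rw [norm_prod]
      refine Finset.prod_le_one (fun i _ => norm_nonneg _) fun i _ => ?_
      rw [Complex.norm_real, Real.norm_of_nonneg (discWeight_nonneg hs0 _)]
      exact discWeight_le_one hs1 _
    rw [norm_mul]
    calc _ ≤ 1 * (n.factorial * (ρ * Real.exp (Real.pi * ρ * R ^ 2)) ^ n) :=
          mul_le_mul h1 (norm_alphaDet_le (abs_neg_one_div_natCast_le hk) _ fun i j =>
            norm_truncatedGinibre_le hρ N (hx i) (hx j)) (norm_nonneg _) zero_le_one
      _ = _ := one_mul _

/-- Both sides are integrals against correlation functions, those of the truncated kernel and of the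
full one; the truncated integrands converge pointwise and are uniformly bounded on a finite measure
space. -/
theorem tendsto_eigenEsymm (hρ : 0 < ρ) (hs0 : 0 ≤ s) (hs1 : s ≤ 1) (h0 : 0 ≤ r₁)
    (h12 : r₁ ≤ r₂) (h2R : r₂ ≤ R) (hk : 1 ≤ k) (n : ℕ) :
    Filter.Tendsto (fun N => eigenEsymm k (mixedMass ρ r₁ r₂ s) N n) Filter.atTop
      (𝓝 (correlationIntegral ρ R r₁ r₂ s k n / n.factorial)) := by
  have h : Filter.Tendsto (fun N => (n.factorial : ℝ) * eigenEsymm k (mixedMass ρ r₁ r₂ s) N n)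
      Filter.atTop (𝓝 (correlationIntegral ρ R r₁ r₂ s k n)) := by
    simp_rw [← integral_truncated_eq (R := R) hρ hs0 hs1 h0 h12 h2R hk _ n]
    refine MeasureTheory.tendsto_integral_of_dominated_convergence
      (fun _ => n.factorial * (ρ * Real.exp (Real.pi * ρ * R ^ 2)) ^ n) (fun N => ?_)
      (MeasureTheory.integrable_const _) (fun N => ?_) ?_
    · exact aestronglyMeasurable_prod_discWeight_mul (continuous_truncatedGinibre ρ N) _ n _
    · filter_upwards [ae_pi_restrict_closedBall R n] with x hx
      exact norm_prod_discWeight_mul_le hs0 hs1 x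
        (norm_alphaDet_le (abs_neg_one_div_natCast_le hk) _ fun i j =>
            norm_truncatedGinibre_le hρ N (hx i) (hx j))
    · refine Filter.Eventually.of_forall fun x => Filter.Tendsto.const_mul _ ?_
      exact (Complex.continuous_re.tendsto _).comp
        (tendsto_alphaDet_truncatedGinibre hρ (-1 / (k : ℝ)) x)
  have h' := h.div_const (n.factorial : ℝ)
  refine h'.congr fun N => ?_
  rw [mul_div_cancel_left₀]
  positivity

theorem lintegral_correlation_eq (hρ : 0 < ρ) (hs0 : 0 ≤ s) (hs1 : s ≤ 1) (hk : 1 ≤ k) (n : ℕ) :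
    ∫⁻ x in Set.univ.pi (fun _ : Fin n => Metric.closedBall (0 : ℂ) R),
      (∏ i, ENNReal.ofReal (discWeight r₁ r₂ s (x i))) * ENNReal.ofReal
        (alphaDet (-1 / (k : ℝ)) (Matrix.of fun i j => ginibreKernel ρ (x i) (x j))).re =
      ENNReal.ofReal (correlationIntegral ρ R r₁ r₂ s k n) := by
  rw [MeasureTheory.volume_pi, MeasureTheory.Measure.restrict_pi_pi, correlationIntegral,
    MeasureTheory.ofReal_integral_eq_lintegral_ofReal]
  · refine MeasureTheory.lintegral_congr fun x => ?_
    rw [ENNReal.ofReal_mul (Finset.prod_nonneg fun i _ => discWeight_nonneg hs0 _),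
      ENNReal.ofReal_prod_of_nonneg fun _ _ => discWeight_nonneg hs0 _]
  · refine MeasureTheory.Integrable.of_bound
      (aestronglyMeasurable_prod_discWeight_mul (continuous_ginibreKernel ρ) _ n _)
      (n.factorial * (ρ * Real.exp (Real.pi * ρ * R ^ 2)) ^ n) ?_
    filter_upwards [ae_pi_restrict_closedBall R n] with x hx
    exact norm_prod_discWeight_mul_le hs0 hs1 x
      (norm_alphaDet_le (abs_neg_one_div_natCast_le hk) _ fun i j =>
        le_of_tendsto' (tendsto_truncatedGinibre hρ (x i) (x j)).norm fun N =>
          norm_truncatedGinibre_le hρ N (hx i) (hx j))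
  · exact Filter.Eventually.of_forall fun x => mul_nonneg
      (Finset.prod_nonneg fun i _ => discWeight_nonneg hs0 _)
      (alphaDet_ginibreKernel_nonneg hρ hk x)

theorem correlationIntegral_nonneg (hρ : 0 < ρ) (hs0 : 0 ≤ s) (hk : 1 ≤ k) (n : ℕ) :
    0 ≤ correlationIntegral ρ R r₁ r₂ s k n :=
  MeasureTheory.integral_nonneg fun x => mul_nonneg
      (Finset.prod_nonneg fun _ _ => discWeight_nonneg hs0 _)
      (alphaDet_ginibreKernel_nonneg hρ hk x)

theorem correlationIntegral_div_factorial_le (hρ : 0 < ρ) (hs0 : 0 ≤ s) (hs1 : s ≤ 1)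
    (h0 : 0 ≤ r₁) (h12 : r₁ ≤ r₂) (h2R : r₂ ≤ R) (hk : 1 ≤ k) (n : ℕ) :
    correlationIntegral ρ R r₁ r₂ s k n / n.factorial ≤
      (∑' a, mixedMass ρ r₁ r₂ s a) ^ n / n.factorial :=
  le_of_tendsto' (tendsto_eigenEsymm hρ hs0 hs1 h0 h12 h2R hk n) fun N =>
    eigenEsymm_le (mixedMass_nonneg hρ hs0 hs1 r₁ r₂) (summable_mixedMass hρ r₁ r₂ s) hk N n

/-- The alternating series of the factorial moments is the infinite product. -/
theorem tendsto_prod_tsum_correlationIntegral (hρ : 0 < ρ) (hs0 : 0 ≤ s) (hs1 : s ≤ 1)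
    (h0 : 0 ≤ r₁) (h12 : r₁ ≤ r₂) (h2R : r₂ ≤ R) (hk : 1 ≤ k) :
    Filter.Tendsto (fun N => (∏ a ∈ Finset.range N, (1 - mixedMass ρ r₁ r₂ s a / k)) ^ k)
      Filter.atTop
      (𝓝 (∑' n, (-1 : ℝ) ^ n * (correlationIntegral ρ R r₁ r₂ s k n / n.factorial))) := by
  simp_rw [← (hasSum_eigenEsymm k (mixedMass ρ r₁ r₂ s) _).tsum_eq]
  refine tendsto_tsum_of_dominated_convergence
    (Real.summable_pow_div_factorial (∑' a, mixedMass ρ r₁ r₂ s a))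
    (fun n => (tendsto_eigenEsymm hρ hs0 hs1 h0 h12 h2R hk n).const_mul _)
    (Filter.Eventually.of_forall fun N n => ?_)
  have hp := mixedMass_nonneg hρ hs0 hs1 r₁ r₂
  rw [norm_mul, norm_pow, norm_neg, norm_one, one_pow, one_mul,
    Real.norm_of_nonneg (eigenEsymm_nonneg hp k N n)]
  exact eigenEsymm_le hp (summable_mixedMass hρ r₁ r₂ s) hk N n

end CorrelationIntegral

/-! ### Point counts and their joint generating function -/

/-- The number of points of `S` in `A`. -/
noncomputable def pointCount (S : Finset ℂ) (A : Set ℂ) : ℕ := Set.ncard ((S : Set ℂ) ∩ A)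

theorem pointCount_eq_card_filter (S : Finset ℂ) (A : Set ℂ) [DecidablePred (· ∈ A)] :
    pointCount S A = (S.filter (· ∈ A)).card := by
  rw [pointCount, ← Set.ncard_coe_finset, Finset.coe_filter]
  rfl

theorem prod_discWeight {M : Type*} [CommMonoid M] (r₁ r₂ s : ℝ) (S : Finset ℂ) (g : ℝ → M)
    (hg : g 0 = 1) :
    ∏ x ∈ S, g (discWeight r₁ r₂ s x) = g 1 ^ pointCount S (Metric.closedBall 0 r₁) *
      g s ^ pointCount S (Metric.closedBall 0 r₂ \ Metric.closedBall 0 r₁) := by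
  classical
  rw [pointCount_eq_card_filter, pointCount_eq_card_filter, ← Finset.prod_const,
    ← Finset.prod_const, Finset.prod_filter, Finset.prod_filter, ← Finset.prod_mul_distrib]
  refine Finset.prod_congr rfl fun x _ => ?_
  unfold discWeight
  by_cases h1 : ‖x‖ ≤ r₁
  · simp [h1]
  · by_cases h2 : ‖x‖ ≤ r₂ <;> simp [h1, h2, hg]

/-- The elementary symmetric function of the weights of the points of `S`. -/
noncomputable def pointEsymm (r₁ r₂ s : ℝ) (n : ℕ) (S : Finset ℂ) : ℝ :=
  ∑ T ∈ Finset.powersetCard n S, ∏ x ∈ T, discWeight r₁ r₂ s x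

theorem pointEsymm_nonneg {s : ℝ} (hs : 0 ≤ s) (r₁ r₂ : ℝ) (n : ℕ) (S : Finset ℂ) :
    0 ≤ pointEsymm r₁ r₂ s n S :=
  Finset.sum_nonneg fun _ _ => Finset.prod_nonneg fun _ _ => discWeight_nonneg hs _

/-- This shows that the quantity depends only on the two counts, whence its measurability. -/
theorem pointEsymm_eq_coeff (r₁ r₂ s : ℝ) (n : ℕ) (S : Finset ℂ) :
    pointEsymm r₁ r₂ s n S =
      ((1 + Polynomial.C 1 * Polynomial.X) ^ pointCount S (Metric.closedBall 0 r₁) *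
        (1 + Polynomial.C s * Polynomial.X) ^
          pointCount S (Metric.closedBall 0 r₂ \ Metric.closedBall 0 r₁)).coeff n := by
  rw [← prod_discWeight r₁ r₂ s S (fun t => 1 + Polynomial.C t * Polynomial.X) (by simp),
    Finset.prod_one_add, Polynomial.finsetSum_coeff, pointEsymm,
    Finset.powersetCard_eq_filter, Finset.sum_filter]
  refine Finset.sum_congr rfl fun T _ => ?_
  rw [Finset.prod_mul_distrib, Finset.prod_const, ← map_prod, Polynomial.coeff_C_mul_X_pow]
  exact if_congr eq_comm rfl rfl

/-- The finite expansion of `∏ (1 - weight)`. Since `0 ^ 0 = 1`, the first factor is the indicator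
of an empty inner disc. -/
theorem hasSum_pointEsymm (r₁ r₂ s : ℝ) (S : Finset ℂ) :
    HasSum (fun n => (-1 : ℝ) ^ n * pointEsymm r₁ r₂ s n S)
      (0 ^ pointCount S (Metric.closedBall 0 r₁) *
        (1 - s) ^ pointCount S (Metric.closedBall 0 r₂ \ Metric.closedBall 0 r₁)) := by
  have h := prod_discWeight r₁ r₂ s S (fun t => 1 + -t) (by simp)
  simp only [add_neg_cancel, ← sub_eq_add_neg 1 s] at h
  rw [← h, Finset.prod_one_add, Finset.sum_powerset]
  have h2 : ∀ n, (-1 : ℝ) ^ n * pointEsymm r₁ r₂ s n S =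
      ∑ T ∈ Finset.powersetCard n S, ∏ x ∈ T, -discWeight r₁ r₂ s x := by
    intro n
    rw [pointEsymm, Finset.mul_sum]
    refine Finset.sum_congr rfl fun T hT => ?_
    rw [Finset.prod_neg, (Finset.mem_powersetCard.1 hT).2]
  simp_rw [h2]
  refine hasSum_sum_of_ne_finset_zero fun n hn => ?_
  rw [Finset.powersetCard_eq_empty.2, Finset.sum_empty]
  simpa using hn

theorem sum_embedding_points (r₁ r₂ s : ℝ) (n : ℕ) (S : Finset ℂ) :
    ∑ e : Fin n ↪ {x // x ∈ S}, ∏ i, discWeight r₁ r₂ s (e i : ℂ) =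
      n.factorial * pointEsymm r₁ r₂ s n S := by
  classical
  have h := sum_embedding_prod n (fun x : {x // x ∈ S} => discWeight r₁ r₂ s (x : ℂ))
  have h2 : ∑ T ∈ Finset.powersetCard n (Finset.univ : Finset {x // x ∈ S}),
      ∏ x ∈ T, discWeight r₁ r₂ s (x : ℂ) = pointEsymm r₁ r₂ s n S := by
    have hS : (Finset.univ : Finset {x // x ∈ S}).map (Function.Embedding.subtype _) = S := by
      ext x; simp
    rw [pointEsymm]
    conv_rhs => rw [← hS, Finset.powersetCard_map, Finset.sum_map]
    refine Finset.sum_congr rfl fun T _ => ?_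
    exact (Finset.prod_map T (Function.Embedding.subtype _) _).symm
  rw [← h2, ← h]

section GinibreProcess

variable {Ω : Type*} [MeasurableSpace Ω] {μ : MeasureTheory.Measure Ω}
  {k : ℕ} {ρ R : ℝ} {K : Ω → Finset ℂ}

theorem IsAlphaDPP.measurable_pointCount {α : ℝ} {O : Set ℂ} {κ : ℂ → ℂ → ℂ}
    (hK : IsAlphaDPP μ α O κ K) {A : Set ℂ} (hA : MeasurableSet A) :
    Measurable fun ω => pointCount (K ω) A :=
  hK.measurable_count A hA

theorem measurable_pointEsymm
    (hK : IsAlphaDPP μ (-1 / (k : ℝ)) (Metric.closedBall 0 R) (ginibreKernel ρ) K)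
    (r₁ r₂ s : ℝ) (n : ℕ) : Measurable fun ω => pointEsymm r₁ r₂ s n (K ω) := by
  simp_rw [pointEsymm_eq_coeff]
  have h1 := hK.measurable_pointCount
    (Metric.isClosed_closedBall (x := (0 : ℂ)) (ε := r₁)).measurableSet
  have h2 := hK.measurable_pointCount
    ((Metric.isClosed_closedBall (x := (0 : ℂ)) (ε := r₂)).measurableSet.diff
      (Metric.isClosed_closedBall (x := (0 : ℂ)) (ε := r₁)).measurableSet)
  have h3 : ∀ Φ : ℕ → ℕ → ℝ, Measurable fun ω =>
      Φ (pointCount (K ω) (Metric.closedBall 0 r₁))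
        (pointCount (K ω) (Metric.closedBall 0 r₂ \ Metric.closedBall 0 r₁)) := fun Φ =>
    (measurable_of_countable fun p : ℕ × ℕ => Φ p.1 p.2).comp (h1.prodMk h2)
  exact h3 fun i j => ((1 + Polynomial.C 1 * Polynomial.X) ^ i *
    (1 + Polynomial.C s * Polynomial.X) ^ j).coeff n

theorem lintegral_pointEsymm (hρ : 0 < ρ) (hk : 1 ≤ k)
    (hK : IsAlphaDPP μ (-1 / (k : ℝ)) (Metric.closedBall 0 R) (ginibreKernel ρ) K)
    {s : ℝ} (hs0 : 0 ≤ s) (hs1 : s ≤ 1) (r₁ r₂ : ℝ) (n : ℕ) :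
    ∫⁻ ω, ENNReal.ofReal (n.factorial * pointEsymm r₁ r₂ s n (K ω)) ∂μ =
      ENNReal.ofReal (correlationIntegral ρ R r₁ r₂ s k n) := by
  rw [← lintegral_correlation_eq hρ hs0 hs1 hk n, ← hK.correlation n
    (fun x => ∏ i, ENNReal.ofReal (discWeight r₁ r₂ s (x i)))
    (Finset.measurable_prod _ fun i _ =>
      ((measurable_discWeight r₁ r₂ s).comp (measurable_pi_apply i)).ennreal_ofReal)]
  refine MeasureTheory.lintegral_congr fun ω => ?_
  rw [← sum_embedding_points, ENNReal.ofReal_sum_of_nonneg fun e _ =>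
    Finset.prod_nonneg fun i _ => discWeight_nonneg hs0 _]
  refine Finset.sum_congr rfl fun e _ => ?_
  rw [ENNReal.ofReal_prod_of_nonneg fun i _ => discWeight_nonneg hs0 _]

theorem integrable_pointEsymm (hρ : 0 < ρ) (hk : 1 ≤ k)
    (hK : IsAlphaDPP μ (-1 / (k : ℝ)) (Metric.closedBall 0 R) (ginibreKernel ρ) K)
    {s : ℝ} (hs0 : 0 ≤ s) (hs1 : s ≤ 1) (r₁ r₂ : ℝ) (n : ℕ) :
    MeasureTheory.Integrable (fun ω => pointEsymm r₁ r₂ s n (K ω)) μ ∧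
      ∫ ω, pointEsymm r₁ r₂ s n (K ω) ∂μ =
        correlationIntegral ρ R r₁ r₂ s k n / n.factorial := by
  have hn : (n.factorial : ℝ) ≠ 0 := by positivity
  have hm : MeasureTheory.AEStronglyMeasurable
      (fun ω => (n.factorial : ℝ) * pointEsymm r₁ r₂ s n (K ω)) μ :=
    ((measurable_pointEsymm hK r₁ r₂ s n).const_mul _).aestronglyMeasurable
  have hnn : 0 ≤ᵐ[μ] fun ω => (n.factorial : ℝ) * pointEsymm r₁ r₂ s n (K ω) :=
    Filter.Eventually.of_forall fun ω =>
      mul_nonneg (by positivity) (pointEsymm_nonneg hs0 r₁ r₂ n _)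
  have hl := lintegral_pointEsymm hρ hk hK hs0 hs1 r₁ r₂ n
  have hi : MeasureTheory.Integrable
      (fun ω => (n.factorial : ℝ) * pointEsymm r₁ r₂ s n (K ω)) μ := by
    rw [← MeasureTheory.lintegral_ofReal_ne_top_iff_integrable hm hnn, hl]
    exact ENNReal.ofReal_ne_top
  refine ⟨?_, ?_⟩
  · have := hi.const_mul (n.factorial : ℝ)⁻¹
    refine this.congr (Filter.Eventually.of_forall fun ω => ?_)
    simp only
    rw [inv_mul_cancel_left₀ hn]
  · rw [eq_div_iff hn, mul_comm, ← MeasureTheory.integral_const_mul,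
      MeasureTheory.integral_eq_lintegral_of_nonneg_ae hnn hm, hl,
      ENNReal.toReal_ofReal (correlationIntegral_nonneg hρ hs0 hk n)]

/-- The probability generating function of the numbers of points in a disc and an annulus. -/
noncomputable def mixedProduct (k : ℕ) (ρ r₁ r₂ s : ℝ) : ℝ :=
  (∏' a, (1 - mixedMass ρ r₁ r₂ s a / k)) ^ k

theorem multipliable_one_sub_div {p : ℕ → ℝ} (hp : Summable p) (k : ℕ) :
    Multipliable fun a => 1 - p a / k := by
  simp_rw [sub_eq_add_neg]
  exact Real.multipliable_one_add_of_summable (hp.div_const _).neg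

theorem integral_zero_pow_mul_pow (hρ : 0 < ρ) (hk : 1 ≤ k)
    (hK : IsAlphaDPP μ (-1 / (k : ℝ)) (Metric.closedBall 0 R) (ginibreKernel ρ) K)
    {s r₁ r₂ : ℝ} (hs0 : 0 ≤ s) (hs1 : s ≤ 1) (h0 : 0 ≤ r₁) (h12 : r₁ ≤ r₂) (h2R : r₂ ≤ R) :
    ∫ ω, (0 : ℝ) ^ pointCount (K ω) (Metric.closedBall 0 r₁) *
        (1 - s) ^ pointCount (K ω) (Metric.closedBall 0 r₂ \ Metric.closedBall 0 r₁) ∂μ =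
      mixedProduct k ρ r₁ r₂ s := by
  have hE := fun n => integrable_pointEsymm hρ hk hK hs0 hs1 r₁ r₂ n
  have hnorm : ∀ n, ∫ ω, ‖(-1 : ℝ) ^ n * pointEsymm r₁ r₂ s n (K ω)‖ ∂μ =
      correlationIntegral ρ R r₁ r₂ s k n / n.factorial := by
    intro n
    rw [← (hE n).2]
    refine MeasureTheory.integral_congr_ae (Filter.Eventually.of_forall fun ω => ?_)
    simp only
    rw [norm_mul, norm_pow, norm_neg, norm_one, one_pow, one_mul,
      Real.norm_of_nonneg (pointEsymm_nonneg hs0 _ _ _ _)]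
  -- Expectation and alternating series commute because the factorial moments divided by `n!` are at
  -- most `M^n / n!`, with `M` the total mass.
  have hsum := MeasureTheory.hasSum_integral_of_summable_integral_norm
    (F := fun n ω => (-1 : ℝ) ^ n * pointEsymm r₁ r₂ s n (K ω)) (μ := μ)
    (fun n => (hE n).1.const_mul _) (by
      simp_rw [hnorm]
      exact Summable.of_nonneg_of_le
        (fun n => div_nonneg (correlationIntegral_nonneg hρ hs0 hk n) (by positivity))
        (fun n => correlationIntegral_div_factorial_le hρ hs0 hs1 h0 h12 h2R hk n)
        (Real.summable_pow_div_factorial _))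
  simp_rw [(hasSum_pointEsymm r₁ r₂ s _).tsum_eq, MeasureTheory.integral_const_mul,
    (hE _).2] at hsum
  rw [← hsum.tsum_eq]
  refine tendsto_nhds_unique
    (tendsto_prod_tsum_correlationIntegral hρ hs0 hs1 h0 h12 h2R hk) ?_
  exact ((multipliable_one_sub_div (summable_mixedMass hρ r₁ r₂ s) k).hasProd.tendsto_prod_nat).pow
    k

end GinibreProcess

/-! ### Strict midpoint convexity of the generating function -/

theorem tprod_pos_of_summable {p : ℕ → ℝ} (hp : Summable p) (h1 : ∀ a, p a < 1) :
    0 < ∏' a, (1 - p a) := by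
  have h := Real.rexp_tsum_eq_tprod (f := fun a => 1 - p a) (fun a => by linarith [h1 a]) (by
    simp_rw [sub_eq_add_neg]
    exact Real.summable_log_one_add_of_summable hp.neg)
  rw [← h]
  exact Real.exp_pos _

/-- A product of nonnegative, nonincreasing, convex functions is again of this kind; the values at
`0`, `1/2`, `1` suffice. Monotonicity is carried along because the induction needs it. -/
theorem midpoint_prod_le {u v : ℕ → ℝ} (hv : ∀ a, 0 ≤ v a) (hu : ∀ a, v a ≤ u a)
    (S : Finset ℕ) :
    0 ≤ ∏ a ∈ S, (u a - v a) ∧ ∏ a ∈ S, (u a - v a) ≤ ∏ a ∈ S, u a ∧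
      0 ≤ ∏ a ∈ S, (u a - v a / 2) ∧
      2 * ∏ a ∈ S, (u a - v a / 2) ≤ ∏ a ∈ S, u a + ∏ a ∈ S, (u a - v a) := by
  induction S using Finset.induction_on with
  | empty => norm_num
  | insert b S hb ih =>
    obtain ⟨h1, h2, h3, h4⟩ := ih
    rw [Finset.prod_insert hb, Finset.prod_insert hb, Finset.prod_insert hb]
    have hvb := hv b
    have hub := hu b
    have hw : 0 ≤ u b - v b := by linarith
    have hm : 0 ≤ u b - v b / 2 := by linarith
    refine ⟨mul_nonneg hw h1, ?_, mul_nonneg hm h3, ?_⟩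
    · exact mul_le_mul (by linarith) h2 h1 (by linarith)
    · nlinarith [mul_nonneg hm (sub_nonneg.2 h4), mul_nonneg hvb (sub_nonneg.2 h2)]

theorem midpoint_mul_lt {a₀ a₁ b₀ b₁ w₀ w₁ w : ℝ} (hb₀ : 0 < b₀) (hb₁ : 0 < b₁) (h₀ : b₀ < a₀)
    (h₁ : b₁ < a₁) (hw₁ : 0 < w₁) (hw : w₁ ≤ w₀) (hm : 2 * w ≤ w₀ + w₁) :
    2 * ((a₀ - b₀ / 2) * ((a₁ - b₁ / 2) * w)) <
      a₀ * (a₁ * w₀) + (a₀ - b₀) * ((a₁ - b₁) * w₁) := by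
  have hM : 0 ≤ (a₀ - b₀ / 2) * (a₁ - b₁ / 2) := mul_nonneg (by linarith) (by linarith)
  have hbb : 0 < b₀ * b₁ * (w₀ + w₁) := mul_pos (mul_pos hb₀ hb₁) (by linarith)
  have hD : 0 ≤ b₀ * (a₁ - b₁) + a₀ * b₁ :=
    add_nonneg (mul_nonneg hb₀.le (by linarith)) (mul_nonneg (by linarith) hb₁.le)
  -- The difference is a sum of nonnegative terms, of which `b₀ b₁ (w₀ + w₁) / 4` is strictly
  -- positive.
  have e : a₀ * (a₁ * w₀) + (a₀ - b₀) * ((a₁ - b₁) * w₁) -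
      2 * ((a₀ - b₀ / 2) * ((a₁ - b₁ / 2) * w)) =
      (a₀ - b₀ / 2) * (a₁ - b₁ / 2) * (w₀ + w₁ - 2 * w) + b₀ * b₁ * (w₀ + w₁) / 4 +
        (b₀ * (a₁ - b₁) + a₀ * b₁) * (w₀ - w₁) / 2 := by
    ring
  have k1 := mul_nonneg hM (sub_nonneg.2 hm)
  have k2 := mul_nonneg hD (sub_nonneg.2 hw)
  linarith

/-- A product of at least two strictly decreasing affine functions is strictly convex. -/
theorem midpoint_tprod_lt {u v : ℕ → ℝ} (hv : ∀ a, 0 < v a) (hu : ∀ a, v a < u a)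
    (hu1 : Summable fun a => 1 - u a) (hvs : Summable v)
:
    0 < ∏' a, (u a - v a) ∧ ∏' a, (u a - v a) ≤ ∏' a, u a ∧ 0 ≤ ∏' a, (u a - v a / 2) ∧
    2 * ∏' a, (u a - v a / 2) < ∏' a, u a + ∏' a, (u a - v a) := by
  have hmul : ∀ t : ℝ, ∀ j, Multipliable fun a => u (a + j) - t * v (a + j) := by
    intro t j
    have : (fun a => u (a + j) - t * v (a + j)) =
        fun a => 1 + -((1 - u (a + j)) + t * v (a + j)) := by ext a; ring
    rw [this]
    exact Real.multipliable_one_add_of_summable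
      ((((summable_nat_add_iff j).2 hu1).add (((summable_nat_add_iff j).2 hvs).mul_left t)).neg)
  have hpos : ∀ j, 0 < ∏' a, (u (a + j) - v (a + j)) := by
    intro j
    have := tprod_pos_of_summable
      (((summable_nat_add_iff j).2 hu1).add ((summable_nat_add_iff j).2 hvs))
      (fun a => by linarith [hu (a + j)])
    convert this using 3
    ring
  -- Two factors are split off because one affine factor alone gives no strictness; the tail needs
  -- only weak convexity.
  have hsplit : ∀ t : ℝ, ∏' a, (u a - t * v a) =
      (u 0 - t * v 0) * ((u 1 - t * v 1) * ∏' a, (u (a + 2) - t * v (a + 2))) := by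
    intro t
    have e1 := tprod_eq_zero_mul' (f := fun a => u a - t * v a) (hmul t 1)
    have e2 := tprod_eq_zero_mul' (f := fun a => u (a + 1) - t * v (a + 1)) (hmul t 2)
    exact e1.trans (congrArg _ e2)
  have htail : ∀ j, ∏' a, (u (a + j) - v (a + j)) ≤ ∏' a, u (a + j) ∧
      0 ≤ ∏' a, (u (a + j) - v (a + j) / 2) ∧
      2 * ∏' a, (u (a + j) - v (a + j) / 2) ≤
        ∏' a, u (a + j) + ∏' a, (u (a + j) - v (a + j)) := by
    intro j
    have ht0 := (hmul 0 j).hasProd.tendsto_prod_nat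
    have ht1 := (hmul 1 j).hasProd.tendsto_prod_nat
    have hth := (hmul (1 / 2) j).hasProd.tendsto_prod_nat
    simp only [zero_mul, sub_zero, one_mul, one_div, inv_mul_eq_div] at ht0 ht1 hth
    have hf := fun n => midpoint_prod_le (u := fun a => u (a + j)) (v := fun a => v (a + j))
      (fun a => (hv _).le) (fun a => (hu _).le) (Finset.range n)
    exact ⟨le_of_tendsto_of_tendsto' ht1 ht0 fun n => (hf n).2.1,
      ge_of_tendsto' hth fun n => (hf n).2.2.1,
      le_of_tendsto_of_tendsto' (hth.const_mul 2) (ht0.add ht1) fun n => (hf n).2.2.2⟩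
  refine ⟨hpos 0, (htail 0).1, (htail 0).2.1, ?_⟩
  have h0 := hsplit 0
  have h1 := hsplit 1
  have hh := hsplit (1 / 2)
  simp only [zero_mul, sub_zero, one_mul, one_div, inv_mul_eq_div] at h0 h1 hh
  rw [h0, h1, hh]
  have hp2 := hpos 2
  obtain ⟨ha, -, hb⟩ := htail 2
  exact midpoint_mul_lt (hv 0) (hv 1) (hu 0) (hu 1) hp2 ha hb

theorem mixedProduct_midpoint_lt {k : ℕ} (hk : 1 ≤ k) {ρ r₁ r₂ : ℝ} (hρ : 0 < ρ) (h0 : 0 ≤ r₁)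
    (h12 : r₁ < r₂) :
    2 * mixedProduct k ρ r₁ r₂ (1 / 2) < mixedProduct k ρ r₁ r₂ 0 + mixedProduct k ρ r₁ r₂ 1 := by
  have hk1 : (1 : ℝ) ≤ k := by exact_mod_cast hk
  have hk0 : (0 : ℝ) < k := by linarith
  let u : ℕ → ℝ := fun a => 1 - ginibreMass ρ r₁ a / k
  let v : ℕ → ℝ := fun a => (ginibreMass ρ r₂ a - ginibreMass ρ r₁ a) / k
  have huv : ∀ t a, 1 - mixedMass ρ r₁ r₂ t a / k = u a - t * v a := by
    intro t a
    simp only [u, v, mixedMass]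
    ring
  have hlt := fun a => ginibreMass_strictMono hρ h0 h12 a
  obtain ⟨hpos, hle, hnn, hmid⟩ := midpoint_tprod_lt (u := u) (v := v)
    (fun a => div_pos (by linarith [hlt a]) hk0)
    (fun a => by
      have h1 := ginibreMass_lt_one hρ r₂ a
      have h2 : ginibreMass ρ r₂ a / k < 1 := (div_lt_one hk0).2 (by linarith)
      simp only [u, v, sub_div]
      linarith)
    (by
      simp only [u, sub_sub_cancel]
      exact (summable_ginibreMass hρ r₁).div_const _)
    (((summable_ginibreMass hρ r₂).sub (summable_ginibreMass hρ r₁)).div_const _)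
  simp only [mixedProduct, huv, zero_mul, sub_zero, one_mul, one_div, inv_mul_eq_div]
  generalize ∏' a, (u a - v a / 2) = Gh at *
  generalize ∏' a, (u a - v a) = G1 at *
  generalize ∏' a, u a = G0 at *
  -- Power means: `(G0 + G1)^k ≤ 2^(k-1) (G0^k + G1^k)` carries the strict inequality from the
  -- product to its `k`-th power.
  have h2 := add_pow_le (hpos.le.trans hle) hpos.le k
  have h3 : (2 * Gh) ^ k < (G0 + G1) ^ k := pow_lt_pow_left₀ hmid (by linarith) (by omega)
  obtain ⟨j, rfl⟩ : ∃ j, k = j + 1 := ⟨k - 1, by omega⟩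
  rw [mul_pow, pow_succ 2 j] at h3
  rw [Nat.add_sub_cancel] at h2
  have h4 : (2 : ℝ) ^ j * (2 * Gh ^ (j + 1)) < 2 ^ j * (G0 ^ (j + 1) + G1 ^ (j + 1)) := by
    linarith
  exact lt_of_mul_lt_mul_left h4 (by positivity)

/-! ### Void probabilities, the strict gap and the first moment -/

theorem integrable_zero_pow_mul_pow {Ω : Type*} [MeasurableSpace Ω] {μ : MeasureTheory.Measure Ω}
    [MeasureTheory.IsFiniteMeasure μ] {N₁ N₂ : Ω → ℕ} (h₁ : Measurable N₁) (h₂ : Measurable N₂)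
    {t : ℝ} (ht0 : 0 ≤ t) (ht1 : t ≤ 1) :
    MeasureTheory.Integrable (fun ω => (0 : ℝ) ^ N₁ ω * t ^ N₂ ω) μ := by
  refine MeasureTheory.Integrable.of_bound (C := 1) ?_ (Filter.Eventually.of_forall fun ω => ?_)
  · exact ((measurable_of_countable fun p : ℕ × ℕ => (0 : ℝ) ^ p.1 * t ^ p.2).comp
      (h₁.prodMk h₂)).aestronglyMeasurable
  · rw [norm_mul, norm_pow, norm_pow, norm_zero, Real.norm_of_nonneg ht0]
    exact mul_le_one₀ (pow_le_one₀ le_rfl zero_le_one) (pow_nonneg ht0 _) (pow_le_one₀ ht0 ht1)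

theorem outageFactor_eq (k : ℕ) (ρ r : ℝ) (a : ℕ) :
    outageFactor (-1 / (k : ℝ)) ρ r a = 1 - ginibreMass ρ r a / k := by
  rw [outageFactor, ginibreMass]
  ring

/-- The exponent `-1/α` is `k`, and `r'` is free because at `s = 0` the annulus has no weight. -/
theorem outageBound_eq {k : ℕ} (ρ r r' : ℝ) :
    outageBound (-1 / (k : ℝ)) ρ r = mixedProduct k ρ r r' 0 := by
  have h : -1 / (-1 / (k : ℝ)) = k := by
    rw [neg_div (k : ℝ) 1, neg_div_neg_eq, one_div_one_div]
  rw [outageBound, h, Real.rpow_natCast, mixedProduct]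
  simp_rw [outageFactor_eq, mixedMass]
  simp

theorem outageBound_zero (α ρ : ℝ) : outageBound α ρ 0 = 1 := by
  simp [outageBound, outageFactor, lowerIncompleteGamma_zero]

section GinibreProcess

variable {Ω : Type*} [MeasurableSpace Ω] {μ : MeasureTheory.Measure Ω}
  {k : ℕ} {ρ R : ℝ} {K : Ω → Finset ℂ}

theorem measureReal_disc_empty (hρ : 0 < ρ) (hk : 1 ≤ k)
    (hK : IsAlphaDPP μ (-1 / (k : ℝ)) (Metric.closedBall 0 R) (ginibreKernel ρ) K)
    {r : ℝ} (h0 : 0 ≤ r) (hR : r ≤ R) :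
    μ.real {ω | pointCount (K ω) (Metric.closedBall 0 r) = 0} =
      outageBound (-1 / (k : ℝ)) ρ r := by
  rw [outageBound_eq ρ r r,
    ← integral_zero_pow_mul_pow hρ hk hK le_rfl zero_le_one h0 le_rfl hR]
  have hm := hK.measurable_pointCount
    (Metric.isClosed_closedBall (x := (0 : ℂ)) (ε := r)).measurableSet
  have hE : MeasurableSet {ω | pointCount (K ω) (Metric.closedBall 0 r) = 0} :=
    hm (measurableSet_singleton 0)
  rw [← MeasureTheory.integral_indicator_one hE]
  refine MeasureTheory.integral_congr_ae (Filter.Eventually.of_forall fun ω => ?_)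
  simp only [sub_zero, one_pow, mul_one, Set.indicator, Set.mem_ofPred_eq, Pi.one_apply]
  split_ifs with h
  · simp [h]
  · simp [h]

/-- With `G` the generating function, the probability is at most `2 G(1/2) - G(1)`, which is less
than `G(0)`, the bound for the disc, by strict midpoint convexity. -/
theorem measureReal_disc_empty_annulus_le_one_lt [MeasureTheory.IsFiniteMeasure μ] (hρ : 0 < ρ) (hk : 1 ≤ k)
    (hK : IsAlphaDPP μ (-1 / (k : ℝ)) (Metric.closedBall 0 R) (ginibreKernel ρ) K)
    {r₁ r₂ : ℝ} (h0 : 0 ≤ r₁) (h12 : r₁ < r₂) (h2R : r₂ ≤ R) :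
    μ.real {ω | pointCount (K ω) (Metric.closedBall 0 r₁) = 0 ∧
      pointCount (K ω) (Metric.closedBall 0 r₂ \ Metric.closedBall 0 r₁) ≤ 1} <
      outageBound (-1 / (k : ℝ)) ρ r₁ := by
  have hm₁ := hK.measurable_pointCount
    (Metric.isClosed_closedBall (x := (0 : ℂ)) (ε := r₁)).measurableSet
  have hm₂ := hK.measurable_pointCount
    ((Metric.isClosed_closedBall (x := (0 : ℂ)) (ε := r₂)).measurableSet.diff
      (Metric.isClosed_closedBall (x := (0 : ℂ)) (ε := r₁)).measurableSet)
  have hE : MeasurableSet {ω | pointCount (K ω) (Metric.closedBall 0 r₁) = 0 ∧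
      pointCount (K ω) (Metric.closedBall 0 r₂ \ Metric.closedBall 0 r₁) ≤ 1} :=
    (hm₁ (measurableSet_singleton 0)).inter (hm₂ (measurableSet_Iic (a := 1)))
  have hF := fun t ht0 ht1 => integral_zero_pow_mul_pow (s := t) hρ hk hK ht0 ht1 h0 h12.le h2R
  have hlt := mixedProduct_midpoint_lt hk hρ h0 h12
  rw [outageBound_eq ρ r₁ r₂]
  -- Pointwise, `1[n ≤ 1] ≤ 2 (1/2)^n - 0^n`, with equality for `n = 0` and `n = 1`.
  suffices h : μ.real {ω | pointCount (K ω) (Metric.closedBall 0 r₁) = 0 ∧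
      pointCount (K ω) (Metric.closedBall 0 r₂ \ Metric.closedBall 0 r₁) ≤ 1} ≤
      2 * mixedProduct k ρ r₁ r₂ (1 / 2) - mixedProduct k ρ r₁ r₂ 1 by linarith
  rw [← hF (1 / 2) (by norm_num) (by norm_num), ← hF 1 (by norm_num) le_rfl,
    ← MeasureTheory.integral_const_mul, ← MeasureTheory.integral_sub,
    ← MeasureTheory.integral_indicator_one hE]
  · refine MeasureTheory.integral_mono
      ((MeasureTheory.integrable_const (1 : ℝ)).indicator hE)
      (((integrable_zero_pow_mul_pow hm₁ hm₂ (by norm_num) (by norm_num)).const_mul _).sub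
        (integrable_zero_pow_mul_pow hm₁ hm₂ (by norm_num) (by norm_num))) fun ω => ?_
    simp only [Set.indicator, Set.mem_ofPred_eq, Pi.one_apply]
    generalize pointCount (K ω) (Metric.closedBall 0 r₁) = n₁
    generalize pointCount (K ω) (Metric.closedBall 0 r₂ \ Metric.closedBall 0 r₁) = n₂
    rcases Nat.eq_zero_or_pos n₁ with rfl | h1
    · rcases n₂ with _ | _ | n₂
      · norm_num
      · norm_num
      · simp
        norm_num
    · simp [h1.ne']
  · exact (integrable_zero_pow_mul_pow hm₁ hm₂ (by norm_num) (by norm_num)).const_mul _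
  · exact integrable_zero_pow_mul_pow hm₁ hm₂ (by norm_num) (by norm_num)

/-- On the diagonal the exponentials of the kernel cancel, so the intensity is constant. -/
theorem re_alphaDet_one_point (α ρ : ℝ) (x : Fin 1 → ℂ) :
    (alphaDet α (Matrix.of fun i j => ginibreKernel ρ (x i) (x j))).re = ρ := by
  have hx : ginibreKernel ρ (x 0) (x 0) = ρ := by
    unfold ginibreKernel
    rw [mul_assoc ((Real.pi * ρ : ℝ) : ℂ), Complex.mul_conj', mul_assoc, ← Complex.exp_add]
    push_cast
    rw [show (Real.pi : ℂ) * ρ * (‖x 0‖ : ℂ) ^ 2 +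
      -(Real.pi * ρ / 2) * ((‖x 0‖ : ℂ) ^ 2 + (‖x 0‖ : ℂ) ^ 2) = 0 by ring, Complex.exp_zero,
      mul_one]
  simp [alphaDet, Equiv.Perm.parts_partition, hx]

/-- The mean number of points in a set bounds the probability that it is hit. -/
theorem measure_pointCount_ne_zero_le {α : ℝ} {O : Set ℂ}
    (hK : IsAlphaDPP μ α O (ginibreKernel ρ) K) {A : Set ℂ} (hA : MeasurableSet A) :
    μ {ω | pointCount (K ω) A ≠ 0} ≤ ENNReal.ofReal ρ * MeasureTheory.volume A := by
  classical
  let g : (Fin 1 → ℂ) → ENNReal := fun x => A.indicator (fun _ => 1) (x 0)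
  have hind : Measurable (A.indicator fun _ => (1 : ENNReal)) := measurable_const.indicator hA
  have hg : Measurable g := hind.comp (measurable_pi_apply 0)
  have hcorr := hK.correlation 1 g hg
  have hm : MeasurableSet {ω | pointCount (K ω) A ≠ 0} :=
    (hK.measurable_pointCount hA) (measurableSet_singleton 0).compl
  calc μ {ω | pointCount (K ω) A ≠ 0}
      = ∫⁻ ω, {ω | pointCount (K ω) A ≠ 0}.indicator 1 ω ∂μ :=
        (MeasureTheory.lintegral_indicator_one hm).symm
    _ ≤ ∫⁻ ω, ∑ e : Fin 1 ↪ {x // x ∈ K ω}, g (fun i => (e i : ℂ)) ∂μ := by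
        refine MeasureTheory.lintegral_mono fun ω => ?_
        by_cases h : pointCount (K ω) A = 0
        · rw [Set.indicator_of_notMem (show ω ∉ {ω | pointCount (K ω) A ≠ 0} from fun h' => h' h)]
          exact bot_le
        rw [Set.indicator_of_mem (show ω ∈ {ω | pointCount (K ω) A ≠ 0} from h)]
        obtain ⟨x, hx⟩ := Set.nonempty_of_ncard_ne_zero h
        let e : Fin 1 ↪ {x // x ∈ K ω} :=
          ⟨fun _ => ⟨x, hx.1⟩, fun i j _ => Subsingleton.elim i j⟩
        have he : g (fun i => (e i : ℂ)) = 1 := Set.indicator_of_mem hx.2 _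
        rw [Pi.one_apply, ← he]
        exact Finset.single_le_sum (f := fun e : Fin 1 ↪ {x // x ∈ K ω} =>
          g (fun i => (e i : ℂ))) (fun _ _ => bot_le) (Finset.mem_univ e)
    _ ≤ ∫⁻ x : Fin 1 → ℂ, g x * ENNReal.ofReal ρ := by
        rw [hcorr]
        simp_rw [re_alphaDet_one_point]
        exact MeasureTheory.setLIntegral_le_lintegral _ _
    _ = ENNReal.ofReal ρ * MeasureTheory.volume A := by
        rw [MeasureTheory.lintegral_mul_const _ hg, mul_comm]
        congr 1
        have := (MeasureTheory.volume_preserving_funUnique (Fin 1) ℂ).lintegral_comp hind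
        rw [MeasureTheory.lintegral_indicator_const hA, one_mul] at this
        exact this

theorem measureReal_annulus_hit_le (hρ : 0 < ρ) {α : ℝ} {O : Set ℂ}
    (hK : IsAlphaDPP μ α O (ginibreKernel ρ) K) {r₁ r₂ : ℝ} (h0 : 0 ≤ r₁) (h12 : r₁ ≤ r₂) :
    μ.real {ω | pointCount (K ω) (Metric.closedBall 0 r₂ \ Metric.closedBall 0 r₁) ≠ 0} ≤
      ρ * (Real.pi * (r₂ ^ 2 - r₁ ^ 2)) := by
  have h := measure_pointCount_ne_zero_le hK
    ((Metric.isClosed_closedBall (x := (0 : ℂ)) (ε := r₂)).measurableSet.diff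
      (Metric.isClosed_closedBall (x := (0 : ℂ)) (ε := r₁)).measurableSet)
  have hv : ∀ r : ℝ, 0 ≤ r → MeasureTheory.volume (Metric.closedBall (0 : ℂ) r) =
      ENNReal.ofReal (Real.pi * r ^ 2) := by
    intro r hr
    rw [Complex.volume_closedBall, mul_comm Real.pi, ENNReal.ofReal_mul (by positivity),
      ENNReal.ofReal_pow hr]
    congr 1
    exact (ENNReal.ofReal_coe_nnreal (p := NNReal.pi)).symm
  rw [MeasureTheory.measure_sdiff (Metric.closedBall_subset_closedBall h12)
    Metric.isClosed_closedBall.measurableSet.nullMeasurableSet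
    (by rw [hv r₁ h0]; exact ENNReal.ofReal_ne_top), hv r₁ h0, hv r₂ (h0.trans h12),
    ← ENNReal.ofReal_sub _ (by positivity), ← ENNReal.ofReal_mul hρ.le] at h
  refine ENNReal.toReal_le_of_le_ofReal ?_ (h.trans_eq (by rw [mul_sub Real.pi]))
  have : r₁ ^ 2 ≤ r₂ ^ 2 := pow_le_pow_left₀ h0 h12 2
  exact mul_nonneg hρ.le (mul_nonneg Real.pi_pos.le (by linarith))

end GinibreProcess

/-! ### Received power and the critical radius -/

theorem pointCount_eq_zero_iff {S : Finset ℂ} {A : Set ℂ} :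
    pointCount S A = 0 ↔ ∀ x ∈ S, x ∉ A := by
  rw [pointCount, Set.ncard_eq_zero (S.finite_toSet.inter_of_left A), ← Set.disjoint_iff_inter_eq_empty,
    Set.disjoint_left]
  rfl

theorem exists_ne_of_one_lt_pointCount {S : Finset ℂ} {A : Set ℂ} (h : 1 < pointCount S A) :
    ∃ x ∈ S, ∃ y ∈ S, x ∈ A ∧ y ∈ A ∧ x ≠ y := by
  obtain ⟨x, hx, y, hy, hne⟩ :=
    (Set.one_lt_ncard (S.finite_toSet.inter_of_left A)).1 h
  exact ⟨x, hx.1, y, hy.1, hx.2, hy.2, hne⟩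

section Power

variable {β PS GS GH wl PC h σ m : ℝ}

theorem surplusThreshold_nonneg (hh : 0 < h) (hm : 0 ≤ m) : 0 ≤ surplusThreshold h σ m := by
  have : (1 : ℝ) ≤ 2 ^ m := Real.one_le_rpow (by norm_num) hm
  exact mul_nonneg (by positivity) (by linarith)

theorem surplusThreshold_pos (hh : 0 < h) (hσ : 0 < σ) (hm : 0 < m) :
    0 < surplusThreshold h σ m := by
  have : (1 : ℝ) < 2 ^ m := Real.one_lt_rpow (by norm_num) hm
  exact mul_pos (by positivity) (by linarith)

theorem transmissionRate_lt_iff {W PH : ℝ} (hh : 0 < h) (hσ : 0 < σ) (hW : 0 < W) :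
    transmissionRate W h σ PC PH < m ↔ max 0 (PH - PC) < surplusThreshold h σ (m / W) := by
  have hx : 0 ≤ max 0 (PH - PC) := le_max_left _ _
  unfold transmissionRate surplusThreshold
  generalize max 0 (PH - PC) = x at hx ⊢
  have hlog : 0 < 1 + h * (x / σ ^ 2) := by positivity
  rw [mul_comm, ← lt_div_iff₀ hW, Real.logb_lt_iff_lt_rpow one_lt_two hlog, ← lt_sub_iff_add_lt',
    mul_div_assoc', div_lt_iff₀ (by positivity), div_mul_eq_mul_div, lt_div_iff₀ hh, mul_comm h,
    mul_comm (σ ^ 2)]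

theorem criticalRadius_pos (hβ : 0 < β) (hPS : 0 < PS) (hGS : 0 < GS) (hGH : 0 < GH)
    (hwl : 0 < wl) (hPC : 0 < PC) (hh : 0 < h) (hm : 0 ≤ m) :
    0 < criticalRadius β PS GS GH wl PC h σ m := by
  have := surplusThreshold_nonneg (σ := σ) hh hm
  exact Real.sqrt_pos.2 (by positivity)

/-- The power received from a single source, in terms of the critical radius. -/
theorem received_power_eq (hβ : 0 < β) (hPS : 0 < PS) (hGS : 0 < GS) (hGH : 0 < GH)
    (hwl : 0 < wl) (hPC : 0 < PC) (hh : 0 < h) (hm : 0 ≤ m) (d : ℝ) :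
    β * PS * (GS * GH * wl ^ 2 / (4 * Real.pi * d) ^ 2) =
      (PC + surplusThreshold h σ m) * criticalRadius β PS GS GH wl PC h σ m ^ 2 / d ^ 2 := by
  have h1 := surplusThreshold_nonneg (σ := σ) hh hm
  rw [criticalRadius, Real.sq_sqrt (by positivity)]
  have h2 : PC + surplusThreshold h σ m ≠ 0 := by positivity
  generalize PC + surplusThreshold h σ m = T at *
  rw [mul_pow]
  field_simp

end Power

/-- An abstract form of the aggregate power: `T γ² / (ε + ‖x‖)²` summed over the sources. -/
theorem le_sum_power {T γ ε : ℝ} (hT : 0 ≤ T) (S : Finset ℂ) {x : ℂ} (hx : x ∈ S)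
    (hpos : 0 < ε + ‖x‖) (hle : ε + ‖x‖ ≤ γ) :
    T ≤ ∑ x ∈ S, T * γ ^ 2 / (ε + ‖x‖) ^ 2 := by
  refine le_trans ?_ (Finset.single_le_sum (f := fun x : ℂ => T * γ ^ 2 / (ε + ‖x‖) ^ 2)
    (fun x _ => by positivity) hx)
  rw [le_div_iff₀ (by positivity)]
  exact mul_le_mul_of_nonneg_left (pow_le_pow_left₀ hpos.le hle 2) hT

/-- Since `(6/5)² ≤ 2`, each of the two sources delivers at least `T / 2`. -/
theorem le_sum_power_of_two {T γ ε : ℝ} (hT : 0 ≤ T) (S : Finset ℂ) {x y : ℂ}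
    (hx : x ∈ S) (hy : y ∈ S) (hxy : x ≠ y) (hx0 : 0 < ε + ‖x‖) (hy0 : 0 < ε + ‖y‖)
    (hxle : ε + ‖x‖ ≤ 6 / 5 * γ) (hyle : ε + ‖y‖ ≤ 6 / 5 * γ) :
    T ≤ ∑ x ∈ S, T * γ ^ 2 / (ε + ‖x‖) ^ 2 := by
  classical
  have hterm : ∀ z : ℂ, 0 < ε + ‖z‖ → ε + ‖z‖ ≤ 6 / 5 * γ →
      T / 2 ≤ T * γ ^ 2 / (ε + ‖z‖) ^ 2 := by
    intro z h0 hz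
    rw [le_div_iff₀ (by positivity)]
    have h1 : (ε + ‖z‖) ^ 2 ≤ (6 / 5 * γ) ^ 2 := pow_le_pow_left₀ h0.le hz 2
    have h2 : (ε + ‖z‖) ^ 2 ≤ 2 * γ ^ 2 := by nlinarith [sq_nonneg γ]
    have := mul_le_mul_of_nonneg_left h2 hT
    linarith
  have hsub : ({x, y} : Finset ℂ) ⊆ S := by
    intro z hz
    rcases Finset.mem_insert.1 hz with rfl | hz
    · exact hx
    · rw [Finset.mem_singleton.1 hz]; exact hy
  have hle := Finset.sum_le_sum_of_subset_of_nonneg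
    (f := fun x : ℂ => T * γ ^ 2 / (ε + ‖x‖) ^ 2) hsub (fun x _ _ => by positivity)
  rw [Finset.sum_pair hxy] at hle
  linarith [hterm x hx0 hxle, hterm y hy0 hyle]

/-! ### Bounds on the outage probability -/

section GinibreProcess

variable {Ω : Type*} [MeasurableSpace Ω] {μ : MeasureTheory.Measure Ω}
  [MeasureTheory.IsProbabilityMeasure μ] {k : ℕ} {ρ R T γ : ℝ} {K : Ω → Finset ℂ}

/-- If the smaller disc is empty, then either the larger one is empty or the annulus between them is
hit. This serves as a modulus of continuity for `B`. -/
theorem outageBound_le_add (hρ : 0 < ρ) (hk : 1 ≤ k)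
    (hK : IsAlphaDPP μ (-1 / (k : ℝ)) (Metric.closedBall 0 R) (ginibreKernel ρ) K)
    {r₁ r₂ : ℝ} (h0 : 0 ≤ r₁) (h12 : r₁ ≤ r₂) (h2R : r₂ ≤ R) :
    outageBound (-1 / (k : ℝ)) ρ r₁ ≤
      outageBound (-1 / (k : ℝ)) ρ r₂ + ρ * (Real.pi * (r₂ ^ 2 - r₁ ^ 2)) := by
  rw [← measureReal_disc_empty hρ hk hK h0 (h12.trans h2R),
    ← measureReal_disc_empty hρ hk hK (h0.trans h12) h2R]
  refine le_trans (MeasureTheory.measureReal_mono ?_) ((MeasureTheory.measureReal_union_le _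
    {ω | pointCount (K ω) (Metric.closedBall 0 r₂ \ Metric.closedBall 0 r₁) ≠ 0}).trans
      (add_le_add_right (measureReal_annulus_hit_le hρ hK h0 h12) _))
  intro ω hω
  by_contra hcon
  simp only [Set.mem_union, Set.mem_ofPred_eq, not_or, not_not] at hcon hω
  refine hcon.1 (pointCount_eq_zero_iff.2 fun x hx hx2 => ?_)
  exact pointCount_eq_zero_iff.1 hcon.2 x hx ⟨hx2, pointCount_eq_zero_iff.1 hω x hx⟩

theorem measureReal_power_lt_le (hρ : 0 < ρ) (hk : 1 ≤ k) (hR : 0 < R)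
    (hK : IsAlphaDPP μ (-1 / (k : ℝ)) (Metric.closedBall 0 R) (ginibreKernel ρ) K)
    (hT : 0 ≤ T) {ε : ℝ} (hε : 0 ≤ ε) :
    μ.real {ω | ∑ x ∈ K ω, T * γ ^ 2 / (ε + ‖x‖) ^ 2 < T} ≤
      outageBound (-1 / (k : ℝ)) ρ (min R (max 0 (γ - ε))) := by
  rcases lt_or_ge γ ε with hlt | hge
  -- Here the radius is `0` and the bound is `1`.
  · rw [max_eq_left (by linarith), min_eq_right hR.le, outageBound_zero]
    exact MeasureTheory.measureReal_le_one
  have hr0 : 0 ≤ min R (max 0 (γ - ε)) := le_min hR.le (le_max_left _ _)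
  rw [max_eq_right (by linarith)] at *
  -- For `ε = 0` a source at the origin would contribute `x / 0 = 0` to the sum; almost surely there
  -- is none.
  have hzero : μ.real {ω | pointCount (K ω) (Metric.closedBall 0 0) ≠ 0} = 0 := by
    have h1 := measure_pointCount_ne_zero_le hK
      (Metric.isClosed_closedBall (x := (0 : ℂ)) (ε := 0)).measurableSet
    rw [Metric.closedBall_zero, MeasureTheory.measure_singleton, mul_zero] at h1
    rw [MeasureTheory.measureReal_def, Metric.closedBall_zero, le_bot_iff.1 h1]
    rfl
  rw [← measureReal_disc_empty hρ hk hK hr0 (min_le_left _ _)]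
  refine le_trans (MeasureTheory.measureReal_mono ?_) ((MeasureTheory.measureReal_union_le
    {ω | pointCount (K ω) (Metric.closedBall 0 (min R (γ - ε))) = 0}
    {ω | pointCount (K ω) (Metric.closedBall 0 0) ≠ 0}).trans_eq (by rw [hzero, add_zero]))
  intro ω hω
  by_contra hcon
  simp only [Set.mem_union, Set.mem_ofPred_eq, not_or, not_not] at hcon hω
  refine hcon.1 (pointCount_eq_zero_iff.2 fun x hx hx2 => ?_)
  have hx0 := pointCount_eq_zero_iff.1 hcon.2 x hx
  rw [mem_closedBall_zero_iff, not_le] at hx0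
  have hxr : ‖x‖ ≤ γ - ε := (mem_closedBall_zero_iff.1 hx2).trans (min_le_right _ _)
  exact absurd hω (not_lt.2 (le_sum_power hT (K ω) hx (by linarith) (by linarith)))

theorem eventually_measureReal_power_lt_le (hρ : 0 < ρ) (hk : 1 ≤ k) (hR : 0 < R)
    (hK : IsAlphaDPP μ (-1 / (k : ℝ)) (Metric.closedBall 0 R) (ginibreKernel ρ) K)
    (hT : 0 ≤ T) (hγ : 0 < γ) (hne : R ≠ γ) :
    ∀ᶠ ε in 𝓝[>] (0 : ℝ), μ.real {ω | ∑ x ∈ K ω, T * γ ^ 2 / (ε + ‖x‖) ^ 2 < T} ≤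
      outageBound (-1 / (k : ℝ)) ρ (min R γ) := by
  rcases lt_or_gt_of_ne hne with hlt | hgt
  -- Once `ε < γ - R`, the shrunken disc still covers the whole window.
  · have hsmall : ∀ᶠ ε in 𝓝[>] (0 : ℝ), ε < γ - R :=
      nhdsWithin_le_nhds (Iio_mem_nhds (by linarith))
    filter_upwards [hsmall, self_mem_nhdsWithin] with ε hε (hε0 : 0 < ε)
    have h := measureReal_power_lt_le (γ := γ) hρ hk hR hK hT hε0.le
    rw [max_eq_right (by linarith), min_eq_left (by linarith)] at h
    rwa [min_eq_left hlt.le]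
  -- With `ε < γ / 10`, sources within `11γ/10` have `ε + ‖x‖ ≤ 6γ/5`, so any two of them prevent
  -- outage.
  · set r₂ := min R (11 / 10 * γ) with hr₂
    have h12 : γ < r₂ := lt_min hgt (by linarith)
    have hgap := measureReal_disc_empty_annulus_le_one_lt hρ hk hK hγ.le h12 (min_le_left _ _)
    rw [min_eq_right hgt.le]
    -- The added term bounds the probability of a source at distance in `(γ - ε, γ]`; it tends to
    -- `0` while the gap stays fixed.
    have hlim : Filter.Tendsto (fun ε : ℝ => μ.real {ω |
        pointCount (K ω) (Metric.closedBall 0 γ) = 0 ∧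
        pointCount (K ω) (Metric.closedBall 0 r₂ \ Metric.closedBall 0 γ) ≤ 1} +
        ρ * (Real.pi * (γ ^ 2 - (γ - ε) ^ 2))) (𝓝[>] 0) (𝓝 (μ.real {ω |
        pointCount (K ω) (Metric.closedBall 0 γ) = 0 ∧
        pointCount (K ω) (Metric.closedBall 0 r₂ \ Metric.closedBall 0 γ) ≤ 1})) := by
      refine tendsto_nhdsWithin_of_tendsto_nhds ?_
      refine (Continuous.tendsto (by fun_prop) 0).trans_eq ?_
      simp
    have hsmall : ∀ᶠ ε in 𝓝[>] (0 : ℝ), ε < γ / 10 :=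
      nhdsWithin_le_nhds (Iio_mem_nhds (by linarith))
    filter_upwards [hlim.eventually_lt_const hgap, hsmall, self_mem_nhdsWithin]
      with ε hε hεγ (hε0 : 0 < ε)
    refine le_trans ?_ hε.le
    refine le_trans (MeasureTheory.measureReal_mono ?_) ((MeasureTheory.measureReal_union_le _
      {ω | pointCount (K ω) (Metric.closedBall 0 γ \ Metric.closedBall 0 (γ - ε)) ≠ 0}).trans
        (add_le_add_right (measureReal_annulus_hit_le hρ hK (by linarith) (by linarith)) _))
    intro ω hω
    by_contra hcon
    simp only [Set.mem_union, Set.mem_ofPred_eq, not_or, not_not] at hcon hω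
    obtain ⟨hcon1, hcon2⟩ := hcon
    refine hcon1 ⟨pointCount_eq_zero_iff.2 fun x hx hxγ => ?_, ?_⟩
    · have hxε : ‖x‖ ≤ γ - ε := by
        by_contra hx'
        refine pointCount_eq_zero_iff.1 hcon2 x hx ⟨hxγ, ?_⟩
        rwa [mem_closedBall_zero_iff]
      have := norm_nonneg x
      exact absurd hω (not_lt.2 (le_sum_power hT (K ω) hx (by linarith) (by linarith)))
    · by_contra htwo
      obtain ⟨x, hx, y, hy, hxA, hyA, hxy⟩ := exists_ne_of_one_lt_pointCount (not_le.1 htwo)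
      have hx2 := (mem_closedBall_zero_iff.1 hxA.1).trans (min_le_right _ _)
      have hy2 := (mem_closedBall_zero_iff.1 hyA.1).trans (min_le_right _ _)
      have hx0 := norm_nonneg x
      have hy0 := norm_nonneg y
      exact absurd hω (not_lt.2 (le_sum_power_of_two hT (K ω) hx hy hxy (by linarith)
        (by linarith) (by linarith) (by linarith)))

theorem eventually_measureReal_power_lt_le_add (hρ : 0 < ρ) (hk : 1 ≤ k) (hR : 0 < R)
    (hK : IsAlphaDPP μ (-1 / (k : ℝ)) (Metric.closedBall 0 R) (ginibreKernel ρ) K)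
    (hT : 0 ≤ T) (hγ : 0 < γ) {δ : ℝ} (hδ : 0 < δ) :
    ∀ᶠ ε in 𝓝[>] (0 : ℝ), μ.real {ω | ∑ x ∈ K ω, T * γ ^ 2 / (ε + ‖x‖) ^ 2 < T} ≤
      outageBound (-1 / (k : ℝ)) ρ (min R γ) + δ := by
  have hlim : Filter.Tendsto (fun ε : ℝ =>
      ρ * (Real.pi * ((min R γ) ^ 2 - (min R (max 0 (γ - ε))) ^ 2))) (𝓝[>] 0) (𝓝 0) := by
    refine tendsto_nhdsWithin_of_tendsto_nhds ?_
    refine (Continuous.tendsto (by fun_prop) 0).trans_eq ?_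
    simp [max_eq_right hγ.le]
  filter_upwards [hlim.eventually_lt_const hδ, self_mem_nhdsWithin] with ε hε (hε0 : 0 < ε)
  have h1 := measureReal_power_lt_le (γ := γ) hρ hk hR hK hT hε0.le
  have h2 := outageBound_le_add hρ hk hK (r₁ := min R (max 0 (γ - ε))) (r₂ := min R γ)
    (le_min hR.le (le_max_left _ _))
    (min_le_min le_rfl (max_le hγ.le (by linarith))) (min_le_left _ _)
  linarith

end GinibreProcess
-- From received power to transmission rate
theorem theorem3 {Ω : Type*} [MeasurableSpace Ω]
    (μ : MeasureTheory.Measure Ω) [MeasureTheory.IsProbabilityMeasure μ]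
    (k : ℕ) (hk : 1 ≤ k) (α : ℝ) (hα : α = -1 / (k : ℝ))
    (ρ R : ℝ) (hρ : 0 < ρ) (hR : 0 < R)
    (K : Ω → Finset ℂ)
    (hK : IsAlphaDPP μ α (Metric.closedBall 0 R) (ginibreKernel ρ) K)
    (β PS GS GH wl PC h σ W m : ℝ)
    (hβ : 0 < β) (hPS : 0 < PS) (hGS : 0 < GS) (hGH : 0 < GH) (hwl : 0 < wl)
    (hPC : 0 < PC) (hh : 0 < h) (hσ : 0 < σ) (hW : 0 < W) (hm : 0 ≤ m)
    (γ : ℝ) (hγ : γ = criticalRadius β PS GS GH wl PC h σ (m / W))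
    (PH : ℝ → Ω → ℝ) (hPH : ∀ ε ω, PH ε ω = harvestedPower β PS GS GH wl ε (K ω)) :
    -- the infinite products below converge
    (∀ r : ℝ, 0 ≤ r → Multipliable (outageFactor α ρ r)) ∧
    -- the rate condition as a power threshold
    (∀ ε : ℝ, 0 ≤ ε →
      μ.real {ω | transmissionRate W h σ PC (PH ε ω) < m} =
        μ.real {ω | max 0 (PH ε ω - PC) < surplusThreshold h σ (m / W)} ∧
      μ.real {ω | transmissionRate W h σ PC (PH ε ω) < m} ≤
        μ.real {ω | PH ε ω < PC + surplusThreshold h σ (m / W)} ∧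
      (0 < m → μ.real {ω | transmissionRate W h σ PC (PH ε ω) < m} =
        μ.real {ω | PH ε ω < PC + surplusThreshold h σ (m / W)})) ∧
    -- the bound for small `ε`
    (R ≠ γ → ∀ᶠ ε in 𝓝[>] (0 : ℝ),
      μ.real {ω | transmissionRate W h σ PC (PH ε ω) < m} ≤ outageBound α ρ (min R γ) ∧
      μ.real {ω | PH ε ω < PC + surplusThreshold h σ (m / W)} ≤
        outageBound α ρ (min R γ)) ∧
    -- the bound as `ε` tends to zero
    (∀ δ : ℝ, 0 < δ → ∀ᶠ ε in 𝓝[>] (0 : ℝ),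
      μ.real {ω | transmissionRate W h σ PC (PH ε ω) < m} ≤
        outageBound α ρ (min R γ) + δ ∧
      μ.real {ω | PH ε ω < PC + surplusThreshold h σ (m / W)} ≤
        outageBound α ρ (min R γ) + δ) ∧
    -- the bound for every `ε`; for `ε = 0` the radius is `min R γ`
    (∀ ε : ℝ, 0 ≤ ε →
      μ.real {ω | transmissionRate W h σ PC (PH ε ω) < m} ≤
        outageBound α ρ (min R (max 0 (γ - ε))) ∧
      μ.real {ω | PH ε ω < PC + surplusThreshold h σ (m / W)} ≤
        outageBound α ρ (min R (max 0 (γ - ε)))) := by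
  subst hα
  have hτ0 := surplusThreshold_nonneg (σ := σ) hh (div_nonneg hm hW.le)
  have hT : 0 ≤ PC + surplusThreshold h σ (m / W) := by linarith
  have hγ0 : 0 < γ := hγ ▸ criticalRadius_pos hβ hPS hGS hGH hwl hPC hh (div_nonneg hm hW.le)
  have hsum : ∀ ε ω, PH ε ω = ∑ x ∈ K ω,
      (PC + surplusThreshold h σ (m / W)) * γ ^ 2 / (ε + ‖x‖) ^ 2 := by
    intro ε ω
    rw [hPH, harvestedPower, hγ]
    exact Finset.sum_congr rfl fun x _ =>
      received_power_eq hβ hPS hGS hGH hwl hPC hh (div_nonneg hm hW.le) _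
  have hset : ∀ ε, {ω | transmissionRate W h σ PC (PH ε ω) < m} =
      {ω | max 0 (PH ε ω - PC) < surplusThreshold h σ (m / W)} := fun ε =>
    Set.ext fun ω => transmissionRate_lt_iff hh hσ hW
  have hle : ∀ ε, μ.real {ω | transmissionRate W h σ PC (PH ε ω) < m} ≤
      μ.real {ω | PH ε ω < PC + surplusThreshold h σ (m / W)} := by
    intro ε
    rw [hset]
    refine MeasureTheory.measureReal_mono fun ω hω => ?_
    have := (le_max_right 0 (PH ε ω - PC)).trans_lt hω
    change PH ε ω < _
    linarith
  refine ⟨fun r _ => ?_, fun ε _ => ⟨by rw [hset], hle ε, fun hm0 => ?_⟩, fun hne => ?_,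
    fun δ hδ => ?_, fun ε hε => ?_⟩
  · have := multipliable_one_sub_div (summable_ginibreMass hρ r) k
    exact this.congr fun a => (outageFactor_eq k ρ r a).symm
  · rw [hset]
    congr 1
    ext ω
    -- Positivity of the threshold lets the truncation at `0` be dropped; for `m = 0` the threshold
    -- is `0` and the rate event is empty.
    have := surplusThreshold_pos hh hσ (div_pos hm0 hW)
    simp only [Set.mem_ofPred_eq, max_lt_iff, this, true_and]
    exact sub_lt_iff_lt_add'
  · filter_upwards [eventually_measureReal_power_lt_le hρ hk hR hK hT hγ0 hne] with ε hε
    simp_rw [← hsum] at hε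
    exact ⟨(hle ε).trans hε, hε⟩
  · filter_upwards [eventually_measureReal_power_lt_le_add hρ hk hR hK hT hγ0 hδ] with ε hε
    simp_rw [← hsum] at hε
    exact ⟨(hle ε).trans hε, hε⟩
  · have h1 := measureReal_power_lt_le (γ := γ) hρ hk hR hK hT hε
    simp_rw [← hsum] at h1
    exact ⟨(hle ε).trans h1, h1⟩
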